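/- Let $\ell,n\ge 1$ be integers, $0<\gamma\le\frac12$, $q\ge 0$ with $16q\ell^2\le 1$, and put $N=\ell n$, $p=2q$, $m_0=\lfloor\log_2(1/\gamma)\rfloor$. For an integer $L\ge0$ let $P_L=\mathrm{Binom}(L,p)$, $Q_L=\mathrm{Binom}(L,q)$, $a_L=\sum_{m_0<m\le L}\bigl[P_L(m)-\tfrac1\gamma Q_L(m)\bigr]$, and define on $\{0,\dots,L\}$ $$P'_L(m)=\begin{cases}P_L(0)+a_L,& m=0,\\ P_L(m),& 1\le m\le m_0,\\ \tfrac1\gamma Q_L(m),& m_0<m\le L,\end{cases}\qquad Q'_L=\tfrac1{1-\gamma}\,(Q_L-\gamma P'_L).$$ Random graph models. $\mathcal G(N,q)$ is the Erdős–Rényi graph on $N$ vertices with edge probability $q$. $\mathcal G(n,k,1,\gamma)$ is the planted clique model: starting from $\mathcal G(n,\gamma)$, add all edges among $k$ vertices chosen uniformly at random and independently of the graph. $\mathcal G(N,K,p,q)$ is the planted dense subgraph model: each vertex belongs to a random set $S$ independently with probability $K/N$ and, given $S$, any two vertices are joined independently, with probability $p$ if both lie in $S$ and with probability $q$ otherwise.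 Randomized reduction. Given a graph $G$ on $[n]$ with adjacency matrix $A$, construct a random graph $\widetilde G$ on $[N]$ as follows. Each vertex of $\widetilde G$ is assigned a parent in $[n]$, uniformly and independently. Let $V_s$ be the set of vertices with parent $s$ and $\ell_s=|V_s|$. Given the parents, independently for all $1\le s\le t\le n$, the number $E(V_s,V_t)$ of edges of $\widetilde G$ between $V_s$ and $V_t$ (inside $V_s$ if $s=t$) is drawn from $\mathrm{Binom}(\binom{\ell_s}{2},q)$ if $s=t$, and for $s<t$ from $$P'_{\ell_s\ell_t}\ \text{ if } A_{st}=1,\ \ell_s,\ell_t\le 2\ell;\qquad Q'_{\ell_s\ell_t}\ \text{ if } A_{st}=0,\ \ell_s,\ell_t\le2\ell;\qquad Q_{\ell_s\ell_t}\ \text{ if }\max\{\ell_s,\ell_t\}>2\ell;$$ given this number, the set of edges between $V_s$ and $V_t$ is uniformly random among the sets of possible edges of that cardinality. Then: 1. The reduction is well defined: for all integers $0\le a,b\le 2\ell$, $P'_{ab}$ and $Q'_{ab}$ are probability distributions on $\{0,\dots,ab\}$, and for each input graph $G$ the above defines a probability distribution for $\widetilde G$. 2. If $G\sim\mathcal G(n,\gamma)$,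 then $\widetilde G\sim\mathcal G(N,q)$ exactly. 3. For every integer $k$ with $1\le k\le n$ and $k\ge 6e\ell$, writing $K=k\ell$: if $G\sim\mathcal G(n,k,1,\gamma)$, then $$d_{\rm TV}\bigl(\mathrm{Law}(\widetilde G),\,\mathcal G(N,K,2q,q)\bigr)\le e^{-\frac K{12}}+1.5\,k\,e^{-\frac{\ell}{18}}+2k^2(8q\ell^2)^{m_0+1}+0.5\sqrt{e^{72e^2q\ell^2}-1}+\sqrt{0.5k}\;e^{-\frac{\ell}{36}},$$ where $d_{\rm TV}(\mu,\nu)=\frac12\sum_\omega|\mu(\omega)-\nu(\omega)|$. -/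

import Mathlib

open MeasureTheory ProbabilityTheory

noncomputable section

namespace PlantedReduction

/-- A real number, read as a probability. It is only used for numbers that lie in `[0, 1]`. -/
def prob (x : ℝ) : unitInterval := Set.projIcc 0 1 zero_le_one x

/-! ### The random graph models -/

/-- The Erdős–Rényi graph on `N` vertices with edge probability `q`. -/
def erdosRenyi (N : ℕ) (q : ℝ) : Measure (SimpleGraph (Fin N)) :=
  SimpleGraph.binomialRandom (Fin N) (prob q)

/-- The complete graph on a vertex set `C`; all other vertices are isolated. -/
def cliqueOn {V : Type*} (C : Set V) : SimpleGraph V :=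
  SimpleGraph.fromRel fun u v => u ∈ C ∧ v ∈ C

/-- The planted clique model: all edges inside a uniformly random set of exactly `k` vertices are
added to an independent Erdős–Rényi graph with edge probability `γ`. -/
def plantedClique (n k : ℕ) (γ : ℝ) : Measure (SimpleGraph (Fin n)) :=
  ((erdosRenyi n γ).prod (uniformOn {C : Set (Fin n) | C.ncard = k})).map
    fun x => x.1 ⊔ cliqueOn x.2

/-- The random graph in which every unordered pair `e` of distinct vertices is an edge with
probability `w e`, independently. -/
def independentEdges (N : ℕ) (w : Sym2 (Fin N) → ℝ) : Measure (SimpleGraph (Fin N)) :=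
  (Measure.pi fun e => bernoulliMeasure True False (prob (w e))).map
    fun f => SimpleGraph.fromEdgeSet {e | f e}

open scoped Classical in
/-- The planted dense subgraph model: every vertex belongs to the random set `S` independently
with probability `K / N`; given `S`, two vertices are joined, independently, with probability `p`
if both of them lie in `S` and with probability `q` otherwise. -/
def plantedDense (N K : ℕ) (p q : ℝ) : Measure (SimpleGraph (Fin N)) :=
  (setBernoulli (Set.univ : Set (Fin N)) (prob ((K : ℝ) / N))).bind fun S =>
    independentEdges N fun e => if ∀ v ∈ e, v ∈ S then p else q

/-- The total variation distance of two laws on a finite space. -/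
def tvDist {Ω : Type*} [Finite Ω] [MeasurableSpace Ω] (μ ν : Measure Ω) : ℝ :=
  (1 / 2) * ∑ᶠ ω, |μ.real {ω} - ν.real {ω}|

/-! ### The edge count kernels -/

/-- The mass that the binomial distribution with parameters `L` and `p` gives to `m`. -/
def binomialMass (L : ℕ) (p : ℝ) (m : ℕ) : ℝ := (binomial L (prob p)).real {m}

/-- The integer `m₀ = ⌊log₂ (1 / γ)⌋`. -/
def cutoff (γ : ℝ) : ℕ := ⌊Real.logb 2 (1 / γ)⌋₊

/-- The number `a = ∑_{m₀ < m ≤ L} (P(m) - Q(m) / γ)`, where `P = Binom(L, 2q)` and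
`Q = Binom(L, q)`. -/
def excess (γ q : ℝ) (L : ℕ) : ℝ :=
  ∑ m ∈ Finset.Ioc (cutoff γ) L, (binomialMass L (2 * q) m - 1 / γ * binomialMass L q m)

/-- The mass function `P'` on `{0, …, L}`. -/
def massP (γ q : ℝ) (L m : ℕ) : ℝ :=
  if m = 0 then binomialMass L (2 * q) 0 + excess γ q L
  else if m ≤ cutoff γ then binomialMass L (2 * q) m
  else 1 / γ * binomialMass L q m

/-- The mass function `Q' = (Q - γ P') / (1 - γ)` on `{0, …, L}`. -/
def massQ (γ q : ℝ) (L m : ℕ) : ℝ :=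
  1 / (1 - γ) * (binomialMass L q m - γ * massP γ q L m)

/-- `f` is a probability mass function on `{0, …, L}`. -/
def IsMassFunction (L : ℕ) (f : ℕ → ℝ) : Prop :=
  (∀ m ≤ L, 0 ≤ f m) ∧ ∑ m ∈ Finset.range (L + 1), f m = 1

/-- The law on `{0, …, L}` with mass function `f`. -/
def ofMass (L : ℕ) (f : ℕ → ℝ) : Measure ℕ :=
  ∑ m ∈ Finset.range (L + 1), ENNReal.ofReal (f m) • Measure.dirac m

/-! ### The randomized reduction -/

/-- The possible edges between the children of `s` and the children of `t` (between two children
of `s`, if `s = t`), where `π v` is the parent of the vertex `v`. -/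
def pairsBetween {N n : ℕ} (π : Fin N → Fin n) (s t : Fin n) : Set (Sym2 (Fin N)) :=
  {e | ∃ u v, u ≠ v ∧ π u = s ∧ π v = t ∧ e = s(u, v)}

/-- The number of children of `s`. -/
def childCount {N n : ℕ} (π : Fin N → Fin n) (s : Fin n) : ℕ := {v | π v = s}.ncard

open scoped Classical in
/-- The conditional law of the number of edges between the children of `s` and those of `t`,
given the parents `π` and the graph `A`. -/
def edgeCountLaw {N n : ℕ} (ℓ : ℕ) (γ q : ℝ) (A : SimpleGraph (Fin n)) (π : Fin N → Fin n)
    (s t : Fin n) : Measure ℕ :=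
  if s = t then binomial ((childCount π s).choose 2) (prob q)
  else if childCount π s ≤ 2 * ℓ ∧ childCount π t ≤ 2 * ℓ then
    if A.Adj s t then
      ofMass (childCount π s * childCount π t) (massP γ q (childCount π s * childCount π t))
    else ofMass (childCount π s * childCount π t) (massQ γ q (childCount π s * childCount π t))
  else binomial (childCount π s * childCount π t) (prob q)

/-- The conditional law of the set of edges between the children of `s` and those of `t`: given
their number, the set of edges is uniform. -/
def edgeBlockLaw {N n : ℕ} (ℓ : ℕ) (γ q : ℝ) (A : SimpleGraph (Fin n)) (π : Fin N → Fin n)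
    (s t : Fin n) : Measure (Set (Sym2 (Fin N))) :=
  (edgeCountLaw ℓ γ q A π s t).bind fun m =>
    uniformOn {F : Set (Sym2 (Fin N)) | F ⊆ pairsBetween π s t ∧ F.ncard = m}

/-- The parents of the `N` vertices: independent and uniform on the `n` vertices of the input. -/
def parentLaw (N n : ℕ) : Measure (Fin N → Fin n) :=
  Measure.pi fun _ => uniformOn (Set.univ : Set (Fin n))

/-- The law of the output graph on `ℓ n` vertices, when the input of the randomized reduction is
the graph `A` on `n` vertices: draw the parents; given these, draw the edge sets of all blocks
`s ≤ t` independently; take their union. -/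
def reduction (ℓ n : ℕ) (γ q : ℝ) (A : SimpleGraph (Fin n)) :
    Measure (SimpleGraph (Fin (ℓ * n))) :=
  (parentLaw (ℓ * n) n).bind fun π =>
    (Measure.pi fun b : {b : Fin n × Fin n // b.1 ≤ b.2} =>
      edgeBlockLaw ℓ γ q A π b.1.1 b.1.2).map
        fun F => SimpleGraph.fromEdgeSet (⋃ b, F b)

end PlantedReduction

end

open MeasureTheory ProbabilityTheory

namespace PlantedReduction

open scoped Classical

/-! ### Laws on finite spaces and their mass functions -/

/-! Parts 1 and 2 rest on the identity `γ P' + (1 - γ) Q' = Q` (`mix_mass`). `P'` is Binom(L, 2q),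
altered so that `γ P' ≤ Q`. For `1 ≤ m ≤ m₀` one has `P(m) ≤ 2^m Q(m) ≤ Q(m) / γ`; above `m₀`
equality is imposed; at 0 there is room because `L ≤ 4ℓ²` gives `L q ≤ 1/4`. Given the parents,
averaging a block over its independent input edge therefore gives a binomial number of edges with
parameter `q`. A uniform set of binomial size consists of independent edges
(`blockMass_binomialMass`), so the image of G(n, γ) is exactly G(N, q).

For part 3, fix the clique `C`, with `|C| = k`. Averaging over the other input edges leaves `P'` on
the off-diagonal blocks inside `C` that are not oversized, and `Q` elsewhere. Replacing `P'` by
Binom(L, 2q) costs at most `4 (8qℓ²)^(m₀+1)` in `ℓ¹` for each of at most `k²` blocks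
(`sum_abs_cliqueMass_sub_splitMass_le`). Then all edges are independent given the parents. Let `S`
be the set of vertices with parent in `C`: each vertex lies in it independently with probability
`k/n = K/N`, as in the planted dense model. If no vertex of `C` has more than `2ℓ` children, the
only difference from that model is that pairs in `S` with a common parent have edge probability `q`
instead of `2q`.

This difference is controlled by the second moment of the likelihood ratio of the pair `(S, G)`. The
square expands over two parent maps with the same `S` (`sum_splitJoint_sq_div_le`). A pair of
vertices contributes a factor at most 1, unless it has a common parent in `C` under both maps; then
the factor is at most `1 + q` (`edge_factor_le`). When vertices are added one at a time, each costs
at most `1 + 4qℓ/n` (`sum_coupledMass_mul_prod_le`), so the second moment is at most `exp(4qℓ²)`.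
Cauchy–Schwarz gives the `ℓ¹` bound `√(exp(4qℓ²) - 1 + 2u)`, where `u` is the probability that some
vertex of `C` has more than `2ℓ` children; by Chernoff and a union bound `u ≤ k exp(-ℓ/18)`.
Averaging over `C` finishes the proof, as the target law depends on `C` only through `k`. -/

instance {V : Type*} [Countable V] : MeasurableSingletonClass (SimpleGraph V) where
  measurableSet_singleton G := by
    have h : ({G} : Set (SimpleGraph V)) = ⋂ u, ⋂ v, {H | H.Adj u v ↔ G.Adj u v} := by
      ext H
      simp only [Set.mem_singleton_iff, Set.mem_iInter, Set.mem_ofPred_eq]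
      exact ⟨fun h => by simp [h], fun h => by ext u v; exact h u v⟩
    rw [h]
    refine MeasurableSet.iInter fun u => MeasurableSet.iInter fun v => ?_
    have hm : Measurable fun H : SimpleGraph V => H.Adj u v :=
      SimpleGraph.measurable_iff_adj.1 measurable_id u v
    exact hm (MeasurableSet.of_discrete (s := {x : Prop | x ↔ G.Adj u v}))

theorem isProbabilityMeasure_bind_of_discrete {α β : Type*}
    [MeasurableSpace α] [DiscreteMeasurableSpace α] [MeasurableSpace β]
    (μ : Measure α) [IsProbabilityMeasure μ]
    (κ : α → Measure β) [∀ a, IsProbabilityMeasure (κ a)] : IsProbabilityMeasure (μ.bind κ) :=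
  ⟨by rw [Measure.bind_apply .univ Measurable.of_discrete.aemeasurable]; simp⟩

section Finite

variable {α β : Type*} [Fintype α] [MeasurableSpace α] [DiscreteMeasurableSpace α]
  [MeasurableSpace β]

theorem bind_real (μ : Measure α) [IsFiniteMeasure μ] (κ : α → Measure β)
    [∀ a, IsFiniteMeasure (κ a)] {s : Set β} (hs : MeasurableSet s) :
    (μ.bind κ).real s = ∑ a, μ.real {a} * (κ a).real s := by
  rw [measureReal_def, Measure.bind_apply hs Measurable.of_discrete.aemeasurable,
    lintegral_fintype, ENNReal.toReal_sum fun a _ => by finiteness]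
  simp [measureReal_def, mul_comm]

theorem map_real (μ : Measure α) [IsFiniteMeasure μ] (f : α → β) {s : Set β}
    (hs : MeasurableSet s) :
    (μ.map f).real s = ∑ a, if f a ∈ s then μ.real {a} else 0 := by
  rw [map_measureReal_apply Measurable.of_discrete hs, ← Finset.sum_filter,
    sum_measureReal_singleton]
  congr 1
  ext a
  simp

theorem sum_real_singleton (μ : Measure α) [IsProbabilityMeasure μ] : ∑ a, μ.real {a} = 1 := by
  rw [sum_measureReal_singleton]
  simp

theorem pi_real {ι : Type*} [Fintype ι] {X : ι → Type*} [∀ i, MeasurableSpace (X i)]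
    (μ : ∀ i, Measure (X i)) [∀ i, IsProbabilityMeasure (μ i)] (f : ∀ i, X i) :
    (Measure.pi μ).real {f} = ∏ i, (μ i).real {f i} := by
  simp [measureReal_def, Measure.pi_singleton, ENNReal.toReal_prod]

theorem uniformOn_real_singleton (s : Set α) (a : α) :
    (uniformOn s).real {a} = if a ∈ s then (1 : ℝ) / s.ncard else 0 := by
  have hc : (Measure.count s) = (s.ncard : ENNReal) := by
    rw [Measure.count_apply_finite s s.toFinite, Set.ncard_eq_toFinset_card s s.toFinite]
  rw [measureReal_def, uniformOn, cond_apply MeasurableSet.of_discrete, hc]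
  split_ifs with h
  · rw [Set.inter_eq_right.2 (Set.singleton_subset_iff.2 h)]
    simp
  · rw [Set.inter_singleton_eq_empty.2 h]
    simp

theorem tvDist_eq {Ω : Type*} [Fintype Ω] [MeasurableSpace Ω] (μ ν : Measure Ω) :
    tvDist μ ν = 1 / 2 * ∑ ω, |μ.real {ω} - ν.real {ω}| := by
  rw [tvDist, finsum_eq_sum_of_fintype]

end Finite

/-! ### Bernoulli and binomial masses. -/

/-- The mass function of a Bernoulli random proposition. -/
noncomputable def bernoulliMass (a : ℝ) (x : Prop) : ℝ := if x then a else 1 - a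

@[simp] theorem bernoulliMass_true (a : ℝ) : bernoulliMass a True = a := by simp [bernoulliMass]

@[simp] theorem bernoulliMass_false (a : ℝ) : bernoulliMass a False = 1 - a := by
  simp [bernoulliMass]

theorem bernoulliMass_nonneg {a : ℝ} (h₀ : 0 ≤ a) (h₁ : a ≤ 1) (x : Prop) :
    0 ≤ bernoulliMass a x := by
  rw [bernoulliMass]
  split_ifs <;> linarith

theorem prod_bernoulliMass {ι : Type*} (s : Finset ι) (a : ℝ) (x : ι → Prop) [DecidablePred x] :
    ∏ i ∈ s, bernoulliMass a (x i) =
      a ^ (s.filter x).card * (1 - a) ^ (s.filter fun i => ¬ x i).card := by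
  have h : ∀ i ∈ s, bernoulliMass a (x i) = if x i then a else 1 - a := by
    intro i _
    by_cases hx : x i <;> simp [bernoulliMass, hx]
  rw [Finset.prod_congr rfl h, Finset.prod_ite, Finset.prod_const, Finset.prod_const]

theorem prob_coe {x : ℝ} (h₀ : 0 ≤ x) (h₁ : x ≤ 1) : (prob x : ℝ) = x := by
  rw [prob, Set.projIcc_of_mem zero_le_one ⟨h₀, h₁⟩]

theorem binomialMass_eq {x : ℝ} (h₀ : 0 ≤ x) (h₁ : x ≤ 1) (L m : ℕ) :
    binomialMass L x m = L.choose m * x ^ m * (1 - x) ^ (L - m) := by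
  rw [binomialMass, binomial_real_singleton, prob_coe h₀ h₁]

theorem binomialMass_nonneg (L : ℕ) (x : ℝ) (m : ℕ) : 0 ≤ binomialMass L x m :=
  measureReal_nonneg

theorem sum_binomialMass {x : ℝ} (h₀ : 0 ≤ x) (h₁ : x ≤ 1) (L : ℕ) :
    ∑ m ∈ Finset.range (L + 1), binomialMass L x m = 1 := by
  simp_rw [binomialMass_eq h₀ h₁]
  have h := add_pow x (1 - x) L
  rw [add_sub_cancel, one_pow] at h
  refine Eq.trans ?_ h.symm
  exact Finset.sum_congr rfl fun m _ => by ring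

theorem isMassFunction_binomialMass {x : ℝ} (h₀ : 0 ≤ x) (h₁ : x ≤ 1) (L : ℕ) :
    IsMassFunction L (binomialMass L x) :=
  ⟨fun m _ => binomialMass_nonneg L x m, sum_binomialMass h₀ h₁ L⟩

theorem binomial_eq_ofMass (L : ℕ) (x : ℝ) :
    binomial L (prob x) = ofMass L (binomialMass L x) := by
  rw [binomial_eq_sum_dirac, ofMass]
  refine Finset.sum_congr (by ext; simp) fun m _ => ?_
  rw [binomialMass, binomial_real_singleton]

/-- The sum of the mass function of a binomial law over the values above `c`. -/
theorem sum_binomialMass_Ioc_le {x : ℝ} (h₀ : 0 ≤ x) (h₁ : x ≤ 1) (L c : ℕ) :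
    ∑ m ∈ Finset.Ioc c L, binomialMass L x m ≤ (L * x) ^ (c + 1) := by
  rcases le_or_gt L c with h | h
  · rw [Finset.Ioc_eq_empty (by omega), Finset.sum_empty]
    positivity
  obtain ⟨d, rfl⟩ : ∃ d, L = c + 1 + d := ⟨L - (c + 1), by omega⟩
  have key : ∀ m ∈ Finset.Ioc c (c + 1 + d), binomialMass (c + 1 + d) x m ≤
      ((c + 1 + d : ℕ) * x) ^ (c + 1) * binomialMass d x (m - (c + 1)) := by
    intro m hm
    rw [Finset.mem_Ioc] at hm
    obtain ⟨j, rfl⟩ : ∃ j, m = c + 1 + j := ⟨m - (c + 1), by omega⟩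
    have hj : j ≤ d := by omega
    rw [binomialMass_eq h₀ h₁, binomialMass_eq h₀ h₁, show c + 1 + j - (c + 1) = j by omega,
      show c + 1 + d - (c + 1 + j) = d - j by omega, mul_pow, pow_add x (c + 1) j]
    -- Count pairs of a set of size `c + 1 + j` and a subset of it of size `c + 1`, choosing the
    -- subset first: there are at most `L ^ (c + 1)` subsets.
    have hch : ((c + 1 + d).choose (c + 1 + j) : ℝ) ≤
        ((c + 1 + d : ℕ) : ℝ) ^ (c + 1) * d.choose j := by
      have h1 := Nat.choose_mul (n := c + 1 + d) (k := c + 1 + j) (s := c + 1)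
        (by omega)
      rw [show c + 1 + d - (c + 1) = d by omega, show c + 1 + j - (c + 1) = j by omega] at h1
      have h2 : 1 ≤ (c + 1 + j).choose (c + 1) := Nat.choose_pos (by omega)
      have h3 : (c + 1 + d).choose (c + 1) ≤ (c + 1 + d) ^ (c + 1) := Nat.choose_le_pow _ _
      have h4 : (c + 1 + d).choose (c + 1 + j) ≤ (c + 1 + d) ^ (c + 1) * d.choose j :=
        calc _ ≤ (c + 1 + d).choose (c + 1 + j) * (c + 1 + j).choose (c + 1) :=
              Nat.le_mul_of_pos_right _ h2
          _ = _ := h1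
          _ ≤ _ := Nat.mul_le_mul_right _ h3
      exact_mod_cast h4
    have hx : (0 : ℝ) ≤ x ^ (c + 1) * x ^ j * (1 - x) ^ (d - j) := by
      have : 0 ≤ 1 - x := by linarith
      positivity
    calc _ = ((c + 1 + d).choose (c + 1 + j) : ℝ) * (x ^ (c + 1) * x ^ j * (1 - x) ^ (d - j)) := by
          ring
      _ ≤ _ := mul_le_mul_of_nonneg_right hch hx
      _ = _ := by ring
  refine (Finset.sum_le_sum key).trans ?_
  rw [← Finset.mul_sum]
  have hs : ∑ m ∈ Finset.Ioc c (c + 1 + d), binomialMass d x (m - (c + 1)) = 1 := by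
    rw [← sum_binomialMass h₀ h₁ d]
    refine Finset.sum_nbij' (fun m => m - (c + 1)) (fun j => c + 1 + j) ?_ ?_ ?_ ?_ ?_ <;>
      intro m hm <;> simp only [Finset.mem_Ioc, Finset.mem_range] at hm ⊢ <;> omega
  rw [hs, mul_one]

/-! ### The mass functions `P'` and `Q'` -/

section Mass

variable {γ q : ℝ} {L : ℕ}

theorem two_pow_cutoff_le (hγ₀ : 0 < γ) (hγ : γ ≤ 1 / 2) : (2 : ℝ) ^ cutoff γ ≤ 1 / γ := by
  have h1 : 0 ≤ Real.logb 2 (1 / γ) :=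
    Real.logb_nonneg one_lt_two (by rw [le_div_iff₀ hγ₀]; linarith)
  have h2 := Nat.floor_le h1
  rw [← Real.rpow_natCast]
  exact (Real.le_logb_iff_rpow_le one_lt_two (by positivity)).1 h2

theorem lt_two_pow_cutoff (hγ₀ : 0 < γ) : 1 / γ < (2 : ℝ) ^ (cutoff γ + 1) := by
  have h2 := Nat.lt_floor_add_one (Real.logb 2 (1 / γ))
  rw [← Real.rpow_natCast]
  push_cast
  exact (Real.logb_lt_iff_lt_rpow one_lt_two (by positivity)).1 h2

theorem sum_range_eq_add_Ioc (c L : ℕ) (f : ℕ → ℝ) :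
    ∑ m ∈ Finset.range (L + 1), f m =
      f 0 + ∑ m ∈ Finset.Ioc 0 (min c L), f m + ∑ m ∈ Finset.Ioc c L, f m := by
  have h : Finset.range (L + 1) = insert 0 (Finset.Ioc 0 (min c L) ∪ Finset.Ioc c L) := by
    ext m
    simp only [Finset.mem_range, Finset.mem_insert, Finset.mem_union, Finset.mem_Ioc]
    omega
  have hd : Disjoint (Finset.Ioc 0 (min c L)) (Finset.Ioc c L) := by
    rw [Finset.disjoint_left]
    intro m
    simp only [Finset.mem_Ioc]
    omega
  rw [h, Finset.sum_insert (by simp), Finset.sum_union hd, add_assoc]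

theorem massP_zero : massP γ q L 0 = binomialMass L (2 * q) 0 + excess γ q L := by
  simp [massP]

theorem massP_of_le {m : ℕ} (h₀ : m ≠ 0) (h : m ≤ cutoff γ) :
    massP γ q L m = binomialMass L (2 * q) m := by
  simp [massP, h₀, h]

theorem massP_of_lt {m : ℕ} (h : cutoff γ < m) : massP γ q L m = 1 / γ * binomialMass L q m := by
  simp [massP, show m ≠ 0 by omega, show ¬ m ≤ cutoff γ by omega]

/-- `excess` is exactly the mass lost by the change above the cutoff, and it is returned at 0. -/
theorem sum_massP (hq₀ : 0 ≤ q) (hq : 2 * q ≤ 1) :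
    ∑ m ∈ Finset.range (L + 1), massP γ q L m = 1 := by
  rw [← sum_binomialMass (x := 2 * q) (by linarith) hq L, sum_range_eq_add_Ioc (cutoff γ),
    sum_range_eq_add_Ioc (cutoff γ) L (binomialMass L (2 * q)), massP_zero, excess,
    Finset.sum_sub_distrib]
  have h1 : ∑ m ∈ Finset.Ioc 0 (min (cutoff γ) L), massP γ q L m =
      ∑ m ∈ Finset.Ioc 0 (min (cutoff γ) L), binomialMass L (2 * q) m := by
    refine Finset.sum_congr rfl fun m hm => ?_
    rw [Finset.mem_Ioc] at hm
    exact massP_of_le (by omega) (by omega)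
  have h2 : ∑ m ∈ Finset.Ioc (cutoff γ) L, massP γ q L m =
      ∑ m ∈ Finset.Ioc (cutoff γ) L, 1 / γ * binomialMass L q m :=
    Finset.sum_congr rfl fun m hm => massP_of_lt (Finset.mem_Ioc.1 hm).1
  rw [h1, h2]
  ring

/-- The cutoff is chosen so that `1 / γ < 2 ^ (m₀ + 1)`: the factor `1 / γ` is absorbed by the power
in the tail bound. -/
theorem sum_Ioc_le_pow (hγ₀ : 0 < γ) (hq₀ : 0 ≤ q) (hq : q ≤ 1) :
    ∑ m ∈ Finset.Ioc (cutoff γ) L, 1 / γ * binomialMass L q m ≤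
      (2 * L * q) ^ (cutoff γ + 1) := by
  rw [← Finset.mul_sum]
  calc _ ≤ (2 : ℝ) ^ (cutoff γ + 1) * (L * q) ^ (cutoff γ + 1) :=
        mul_le_mul (lt_two_pow_cutoff hγ₀).le (sum_binomialMass_Ioc_le hq₀ hq L _)
          (Finset.sum_nonneg fun m _ => binomialMass_nonneg L q m) (by positivity)
    _ = _ := by rw [← mul_pow, ← mul_assoc]

/-- Only the value at 0 could be negative. There Bernoulli's inequality gives `P(0) ≥ 1 - 2Lq ≥
1/2`, and the negative part of the excess is at most `(2Lq)^(m₀+1) ≤ 1/2`. -/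
theorem isMassFunction_massP (hγ₀ : 0 < γ) (hγ : γ ≤ 1 / 2) (hq₀ : 0 ≤ q) (hq : q ≤ 1 / 16)
    (hL : 4 * (L * q) ≤ 1) : IsMassFunction L (massP γ q L) := by
  refine ⟨fun m _ => ?_, sum_massP hq₀ (by linarith)⟩
  rcases Nat.eq_zero_or_pos m with rfl | h₀
  · have h1 : 1 / 2 ≤ binomialMass L (2 * q) 0 := by
      rw [binomialMass_eq (by linarith) (by linarith)]
      have := one_add_mul_le_pow (a := -(2 * q)) (by linarith) L
      simp only [Nat.choose_zero_right, Nat.cast_one, pow_zero, mul_one, one_mul, Nat.sub_zero]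
      rw [sub_eq_add_neg]
      refine le_trans ?_ this
      linarith
    have h2 : -(2 * L * q) ^ (cutoff γ + 1) ≤ excess γ q L := by
      rw [excess, Finset.sum_sub_distrib]
      have := sum_Ioc_le_pow (γ := γ) (L := L) hγ₀ hq₀ (by linarith)
      have : 0 ≤ ∑ m ∈ Finset.Ioc (cutoff γ) L, binomialMass L (2 * q) m :=
        Finset.sum_nonneg fun m _ => binomialMass_nonneg L _ m
      linarith
    have h3 : (2 * L * q) ^ (cutoff γ + 1) ≤ (1 / 2 : ℝ) := by
      have h4 : (2 * L * q) ≤ (1 / 2 : ℝ) := by linarith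
      calc (2 * L * q) ^ (cutoff γ + 1) ≤ (1 / 2 : ℝ) ^ (cutoff γ + 1) := by gcongr
        _ ≤ (1 / 2 : ℝ) ^ 1 := pow_le_pow_of_le_one (by norm_num) (by norm_num) (by omega)
        _ = _ := by norm_num
    rw [massP_zero]
    linarith
  · rcases le_or_gt m (cutoff γ) with h | h
    · rw [massP_of_le h₀.ne' h]
      exact binomialMass_nonneg L _ m
    · rw [massP_of_lt h]
      have := binomialMass_nonneg L q m
      positivity

theorem binomialMass_two_mul_le (hq₀ : 0 ≤ q) (hq : 2 * q ≤ 1) (m : ℕ) :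
    binomialMass L (2 * q) m ≤ 2 ^ m * binomialMass L q m := by
  rw [binomialMass_eq (by linarith) hq, binomialMass_eq hq₀ (by linarith), mul_pow]
  have h1 : (1 - 2 * q) ^ (L - m) ≤ (1 - q) ^ (L - m) :=
    pow_le_pow_left₀ (by linarith) (by linarith) _
  calc _ = (L.choose m * 2 ^ m * q ^ m) * (1 - 2 * q) ^ (L - m) := by ring
    _ ≤ (L.choose m * 2 ^ m * q ^ m) * (1 - q) ^ (L - m) :=
        mul_le_mul_of_nonneg_left h1 (by positivity)
    _ = _ := by ring

/-- Nonnegativity means `γ P' ≤ Q`. At 0 this is `γ P'(0) ≤ 1/2 ≤ Q(0)`; up to the cutoff the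
likelihood ratio is at most `2 ^ m ≤ 1 / γ`; above it there is equality. -/
theorem isMassFunction_massQ (hγ₀ : 0 < γ) (hγ : γ ≤ 1 / 2) (hq₀ : 0 ≤ q) (hq : q ≤ 1 / 16)
    (hL : 4 * (L * q) ≤ 1) : IsMassFunction L (massQ γ q L) := by
  have hP := isMassFunction_massP hγ₀ hγ hq₀ hq hL
  refine ⟨fun m hm => ?_, ?_⟩
  · have hγ' : 0 ≤ 1 / (1 - γ) := by
      have : 0 < 1 - γ := by linarith
      positivity
    refine mul_nonneg hγ' (sub_nonneg.2 ?_)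
    rcases Nat.eq_zero_or_pos m with rfl | h₀
    · have h1 : massP γ q L 0 ≤ 1 := by
        rw [← hP.2]
        exact Finset.single_le_sum (f := massP γ q L)
          (fun i hi => hP.1 i (by simpa [Nat.lt_succ_iff] using hi)) (by simp)
      have h2 : 1 / 2 ≤ binomialMass L q 0 := by
        rw [binomialMass_eq hq₀ (by linarith)]
        have := one_add_mul_le_pow (a := -q) (by linarith) L
        simp only [Nat.choose_zero_right, Nat.cast_one, pow_zero, mul_one, one_mul, Nat.sub_zero]
        rw [sub_eq_add_neg]
        refine le_trans ?_ this
        linarith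
      nlinarith [hP.1 0 hm]
    · rcases le_or_gt m (cutoff γ) with h | h
      · rw [massP_of_le h₀.ne' h]
        have h1 : γ * 2 ^ m ≤ 1 := by
          have h2 : (2 : ℝ) ^ m ≤ 1 / γ :=
            (pow_le_pow_right₀ one_le_two h).trans (two_pow_cutoff_le hγ₀ hγ)
          rw [le_div_iff₀ hγ₀] at h2
          linarith
        calc γ * binomialMass L (2 * q) m ≤ γ * (2 ^ m * binomialMass L q m) :=
              mul_le_mul_of_nonneg_left (binomialMass_two_mul_le hq₀ (by linarith) m) hγ₀.le
          _ = (γ * 2 ^ m) * binomialMass L q m := by ring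
          _ ≤ 1 * binomialMass L q m :=
              mul_le_mul_of_nonneg_right h1 (binomialMass_nonneg L q m)
          _ = _ := one_mul _
      · rw [massP_of_lt h, ← mul_assoc, mul_one_div_cancel hγ₀.ne', one_mul]
  · simp only [massQ]
    rw [← Finset.mul_sum, Finset.sum_sub_distrib, ← Finset.mul_sum, hP.2,
      sum_binomialMass hq₀ (by linarith)]
    have : 1 - γ ≠ 0 := by linarith
    field_simp

theorem mix_mass (hγ : γ ≤ 1 / 2) (m : ℕ) :
    γ * massP γ q L m + (1 - γ) * massQ γ q L m = binomialMass L q m := by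
  have : 1 - γ ≠ 0 := by linarith
  rw [massQ]
  field_simp
  ring

/-- The `ℓ¹` distance of `P'` and the binomial law with parameter `2q`. -/
theorem sum_abs_massP_sub_le (hγ₀ : 0 < γ) (hq₀ : 0 ≤ q) (hq : 2 * q ≤ 1) :
    ∑ m ∈ Finset.range (L + 1), |massP γ q L m - binomialMass L (2 * q) m| ≤
      4 * (2 * L * q) ^ (cutoff γ + 1) := by
  have hP : ∑ m ∈ Finset.Ioc (cutoff γ) L, |binomialMass L (2 * q) m -
      1 / γ * binomialMass L q m| ≤ 2 * (2 * L * q) ^ (cutoff γ + 1) := by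
    have h1 := sum_Ioc_le_pow (γ := γ) (L := L) hγ₀ hq₀ (by linarith)
    have h2 := sum_binomialMass_Ioc_le (x := 2 * q) (by linarith) hq L (cutoff γ)
    calc _ ≤ ∑ m ∈ Finset.Ioc (cutoff γ) L, (binomialMass L (2 * q) m +
            1 / γ * binomialMass L q m) := by
          refine Finset.sum_le_sum fun m _ => abs_sub_le_iff.2 ?_
          have := binomialMass_nonneg L (2 * q) m
          have : 0 ≤ 1 / γ * binomialMass L q m :=
            mul_nonneg (by positivity) (binomialMass_nonneg L q m)
          constructor <;> linarith
      _ ≤ _ := by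
          rw [Finset.sum_add_distrib]
          have : (L : ℝ) * (2 * q) = 2 * L * q := by ring
          rw [this] at h2
          linarith
  -- The change above the cutoff counts twice: term by term there, and once more at 0 through
  -- `excess`.
  rw [sum_range_eq_add_Ioc (cutoff γ), massP_zero, add_sub_cancel_left]
  have h1 : ∑ m ∈ Finset.Ioc 0 (min (cutoff γ) L),
      |massP γ q L m - binomialMass L (2 * q) m| = 0 := by
    refine Finset.sum_eq_zero fun m hm => ?_
    rw [Finset.mem_Ioc] at hm
    rw [massP_of_le (by omega) (by omega), sub_self, abs_zero]
  have h2 : ∑ m ∈ Finset.Ioc (cutoff γ) L, |massP γ q L m - binomialMass L (2 * q) m| =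
      ∑ m ∈ Finset.Ioc (cutoff γ) L, |binomialMass L (2 * q) m - 1 / γ * binomialMass L q m| := by
    refine Finset.sum_congr rfl fun m hm => ?_
    rw [massP_of_lt (Finset.mem_Ioc.1 hm).1, abs_sub_comm]
  have h3 : |excess γ q L| ≤ _ := Finset.abs_sum_le_sum_abs _ _
  rw [h1, h2]
  linarith

end Mass

/-! ### The law of a block of edges -/

theorem ofMass_bind {β : Type*} [MeasurableSpace β] (L : ℕ) (f : ℕ → ℝ) (κ : ℕ → Measure β) :
    (ofMass L f).bind κ = ∑ m ∈ Finset.range (L + 1), ENNReal.ofReal (f m) • κ m := by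
  ext s hs
  rw [Measure.bind_apply hs Measurable.of_discrete.aemeasurable, ofMass,
    lintegral_finsetSum_measure, Measure.finsetSum_apply]
  simp

/-- The mass of a set `F` of edges, when the number of edges in the block `B` has mass function
`f`, and the edge set is uniform given this number. -/
noncomputable def blockMass {α : Type*} (B : Set α) (f : ℕ → ℝ) (F : Set α) : ℝ :=
  if F ⊆ B then f F.ncard / (B.ncard.choose F.ncard) else 0

section Block

variable {α : Type*} [Fintype α] {B : Set α} {f g : ℕ → ℝ}

theorem ncard_subsets_ncard (B : Set α) (m : ℕ) :
    {F : Set α | F ⊆ B ∧ F.ncard = m}.ncard = B.ncard.choose m :=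
  Set.ncard_powerset_ncard B.toFinite m

theorem nonempty_subsets_ncard {m : ℕ} (hm : m ≤ B.ncard) :
    {F : Set α | F ⊆ B ∧ F.ncard = m}.Nonempty := by
  rw [← Set.ncard_pos (Set.toFinite _), ncard_subsets_ncard]
  exact Nat.choose_pos hm

theorem isProbabilityMeasure_block (hf : IsMassFunction B.ncard f) :
    IsProbabilityMeasure ((ofMass B.ncard f).bind fun m =>
      uniformOn {F : Set α | F ⊆ B ∧ F.ncard = m}) := by
  refine ⟨?_⟩
  rw [ofMass_bind, Measure.finsetSum_apply]
  have h : ∀ m ∈ Finset.range (B.ncard + 1), (ENNReal.ofReal (f m) •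
      uniformOn {F : Set α | F ⊆ B ∧ F.ncard = m}) Set.univ = ENNReal.ofReal (f m) := by
    intro m hm
    have := isProbabilityMeasure_uniformOn (Set.toFinite _)
      (nonempty_subsets_ncard (B := B) (m := m) (by simpa [Nat.lt_succ_iff] using hm))
    simp
  rw [Finset.sum_congr rfl h, ← ENNReal.ofReal_sum_of_nonneg, hf.2, ENNReal.ofReal_one]
  exact fun m hm => hf.1 m (by simpa [Nat.lt_succ_iff] using hm)

theorem block_real (hf : IsMassFunction B.ncard f) (F : Set α) :
    ((ofMass B.ncard f).bind fun m => uniformOn {F : Set α | F ⊆ B ∧ F.ncard = m}).real {F} =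
      blockMass B f F := by
  rw [ofMass_bind, measureReal_def, Measure.finsetSum_apply, ENNReal.toReal_sum]
  swap
  · intro m _
    rw [Measure.smul_apply, smul_eq_mul]
    finiteness
  simp_rw [← measureReal_def]
  have h : ∀ m ∈ Finset.range (B.ncard + 1), (ENNReal.ofReal (f m) •
      uniformOn {F : Set α | F ⊆ B ∧ F.ncard = m}).real {F} =
        if m = F.ncard then blockMass B f F else 0 := by
    intro m hm
    rw [measureReal_ennreal_smul_apply, uniformOn_real_singleton, ncard_subsets_ncard,
      ENNReal.toReal_ofReal (hf.1 m (by simpa [Nat.lt_succ_iff] using hm)), blockMass]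
    simp only [Set.mem_ofPred_eq]
    by_cases h1 : F ⊆ B <;> by_cases h2 : F.ncard = m
    · simp [h1, h2, div_eq_mul_inv]
    · simp [h1, h2, Ne.symm h2]
    · simp [h1]
    · simp [h1]
  rw [Finset.sum_congr rfl h, Finset.sum_ite_eq']
  split_ifs with h1
  · rfl
  · rw [blockMass, if_neg]
    intro h2
    exact h1 (Finset.mem_range.2 (Nat.lt_succ_of_le (Set.ncard_le_ncard h2)))

theorem blockMass_nonneg (hf : IsMassFunction B.ncard f) (F : Set α) : 0 ≤ blockMass B f F := by
  rw [blockMass]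
  split_ifs with h
  · exact div_nonneg (hf.1 _ (Set.ncard_le_ncard h)) (Nat.cast_nonneg _)
  · rfl

theorem sum_blockMass (B : Set α) (f : ℕ → ℝ) :
    ∑ F, blockMass B f F = ∑ m ∈ Finset.range (B.ncard + 1), f m := by
  have h1 : ∑ F, blockMass B f F =
      ∑ F ∈ B.toFinset.powerset, f F.card / (B.ncard.choose F.card) := by
    rw [← Fintype.finsetEquivSet.sum_comp, ← Finset.sum_subset (Finset.subset_univ _)]
    · refine Finset.sum_congr rfl fun F hF => ?_
      rw [Finset.mem_powerset, Set.subset_toFinset] at hF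
      simp [blockMass, hF]
    · intro F _ hF
      rw [Finset.mem_powerset, Set.subset_toFinset] at hF
      simp [blockMass, hF]
  rw [h1, Finset.sum_powerset_apply_card (fun m => f m / (B.ncard.choose m)),
    ← Set.ncard_eq_toFinset_card']
  refine Finset.sum_congr rfl fun m hm => ?_
  have : (B.ncard.choose m : ℝ) ≠ 0 :=
    Nat.cast_ne_zero.2 (Nat.choose_pos (by simpa [Nat.lt_succ_iff] using hm)).ne'
  rw [nsmul_eq_mul]
  field_simp

/-- Given the cardinality both laws are uniform, so the absolute difference is itself the block mass
of `|f - g|`. -/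
theorem sum_abs_blockMass_sub (B : Set α) (f g : ℕ → ℝ) :
    ∑ F, |blockMass B f F - blockMass B g F| =
      ∑ m ∈ Finset.range (B.ncard + 1), |f m - g m| := by
  rw [← sum_blockMass]
  refine Finset.sum_congr rfl fun F _ => ?_
  rw [blockMass, blockMass, blockMass]
  split_ifs
  · rw [← sub_div, abs_div, abs_of_nonneg (Nat.cast_nonneg (α := ℝ) _)]
  · simp

/-- A uniform set with binomial cardinality consists of independent edges. -/
theorem blockMass_binomialMass {x : ℝ} (h₀ : 0 ≤ x) (h₁ : x ≤ 1) {F : Set α} (hF : F ⊆ B) :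
    blockMass B (binomialMass B.ncard x) F =
      ∏ e ∈ Finset.univ.filter (· ∈ B), bernoulliMass x (e ∈ F) := by
  have hc : (B.ncard.choose F.ncard : ℝ) ≠ 0 :=
    Nat.cast_ne_zero.2 (Nat.choose_pos (Set.ncard_le_ncard hF)).ne'
  have h1 : ((Finset.univ.filter (· ∈ B)).filter (· ∈ F)).card = F.ncard := by
    rw [Set.ncard_eq_toFinset_card']
    congr 1
    ext e
    simpa using fun h => hF h
  have h2 : ((Finset.univ.filter (· ∈ B)).filter (· ∉ F)).card = B.ncard - F.ncard := by
    rw [← Set.ncard_sdiff hF, Set.ncard_eq_toFinset_card']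
    congr 1
    ext e
    simp
  rw [blockMass, if_pos hF, binomialMass_eq h₀ h₁, prod_bernoulliMass, h1, h2]
  field_simp

end Block

/-! ### The blocks of the reduction -/

section Reduction

variable {N n : ℕ} {π : Fin N → Fin n}

theorem mem_pairsBetween_iff {s t : Fin n} {e : Sym2 (Fin N)} :
    e ∈ pairsBetween π s t ↔ ¬ e.IsDiag ∧ e.map π = s(s, t) := by
  induction e with | _ u v
  simp only [pairsBetween, Set.mem_ofPred_eq, Sym2.mk_isDiag_iff, Sym2.map_mk]
  constructor
  · rintro ⟨a, b, hab, rfl, rfl, h⟩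
    rw [Sym2.eq_iff] at h ⊢
    rcases h with ⟨rfl, rfl⟩ | ⟨rfl, rfl⟩
    · exact ⟨hab, .inl ⟨rfl, rfl⟩⟩
    · exact ⟨hab.symm, .inr ⟨rfl, rfl⟩⟩
  · rintro ⟨h, h'⟩
    rw [Sym2.eq_iff] at h'
    rcases h' with ⟨rfl, rfl⟩ | ⟨rfl, rfl⟩
    · exact ⟨u, v, h, rfl, rfl, rfl⟩
    · exact ⟨v, u, Ne.symm h, rfl, rfl, Sym2.eq_swap⟩

/-- The number of possible edges of a block. -/
noncomputable def blockSize (π : Fin N → Fin n) (s t : Fin n) : ℕ :=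
  if s = t then (childCount π s).choose 2 else childCount π s * childCount π t

theorem ncard_pairsBetween (s t : Fin n) : (pairsBetween π s t).ncard = blockSize π s t := by
  rw [blockSize]
  split_ifs with h
  · subst h
    have h1 : pairsBetween π s s =
        (((Finset.univ.filter (π · = s)).offDiag.image (Function.uncurry Sym2.mk) :
          Finset (Sym2 (Fin N))) :
          Set (Sym2 (Fin N))) := by
      ext e
      simp only [pairsBetween, Set.mem_ofPred_eq, Finset.coe_image, Set.mem_image, Finset.mem_coe,
        Finset.mem_offDiag, Finset.mem_filter_univ, Prod.exists]
      constructor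
      · rintro ⟨u, v, h1, h2, h3, rfl⟩
        exact ⟨u, v, ⟨h2, h3, h1⟩, rfl⟩
      · rintro ⟨u, v, ⟨h2, h3, h1⟩, rfl⟩
        exact ⟨u, v, h1, h2, h3, rfl⟩
    rw [h1, Set.ncard_coe_finset, Sym2.card_image_offDiag, childCount, Set.ncard_eq_toFinset_card']
    congr 2
    ext
    simp
  · have h1 : pairsBetween π s t =
        (fun x : Fin N × Fin N => s(x.1, x.2)) '' ({v | π v = s} ×ˢ {v | π v = t}) := by
      ext e
      simp only [pairsBetween, Set.mem_ofPred_eq, Set.mem_image, Set.mem_prod, Prod.exists]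
      constructor
      · rintro ⟨u, v, h1, h2, h3, rfl⟩
        exact ⟨u, v, ⟨h2, h3⟩, rfl⟩
      · rintro ⟨u, v, ⟨h2, h3⟩, rfl⟩
        exact ⟨u, v, fun h4 => h (by rw [← h2, ← h3, h4]), h2, h3, rfl⟩
    rw [h1, Set.InjOn.ncard_image, Set.ncard_prod, childCount, childCount]
    rintro ⟨u, v⟩ hu ⟨u', v'⟩ hu' he
    simp only [Set.mem_prod, Set.mem_ofPred_eq] at hu hu'
    rw [Sym2.eq_iff] at he
    rcases he with ⟨rfl, rfl⟩ | ⟨rfl, rfl⟩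
    · rfl
    · exact absurd (hu.1.symm.trans hu'.2) h

/-- The conditional mass function of the number of edges of a block; `a` says whether the two
parents are adjacent. -/
noncomputable def countMass (ℓ : ℕ) (γ q : ℝ) (a : Prop) (π : Fin N → Fin n) (s t : Fin n) :
    ℕ → ℝ :=
  if s = t then binomialMass (blockSize π s t) q
  else if childCount π s ≤ 2 * ℓ ∧ childCount π t ≤ 2 * ℓ then
    if a then massP γ q (blockSize π s t) else massQ γ q (blockSize π s t)
  else binomialMass (blockSize π s t) q

theorem edgeCountLaw_eq (ℓ : ℕ) (γ q : ℝ) (A : SimpleGraph (Fin n)) (π : Fin N → Fin n)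
    (s t : Fin n) : edgeCountLaw ℓ γ q A π s t =
      ofMass (pairsBetween π s t).ncard (countMass ℓ γ q (A.Adj s t) π s t) := by
  rw [edgeCountLaw, countMass, ncard_pairsBetween, blockSize]
  split_ifs with h
  all_goals first | rfl | exact binomial_eq_ofMass _ _

theorem blockSize_mul_le {ℓ : ℕ} {q : ℝ} (hq₀ : 0 ≤ q) (hq : 16 * q * (ℓ : ℝ) ^ 2 ≤ 1)
    {a b : ℕ} (ha : a ≤ 2 * ℓ) (hb : b ≤ 2 * ℓ) : 4 * (((a * b : ℕ) : ℝ) * q) ≤ 1 := by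
  have h1 : ((a * b : ℕ) : ℝ) ≤ ((2 * ℓ) * (2 * ℓ) : ℕ) := by
    exact_mod_cast Nat.mul_le_mul ha hb
  push_cast at h1 ⊢
  nlinarith [mul_le_mul_of_nonneg_right h1 hq₀]

theorem le_one_div_sixteen {ℓ : ℕ} (hℓ : 1 ≤ ℓ) {q : ℝ} (hq₀ : 0 ≤ q)
    (hq : 16 * q * (ℓ : ℝ) ^ 2 ≤ 1) : q ≤ 1 / 16 := by
  have h1 : (1 : ℝ) ≤ (ℓ : ℝ) ^ 2 := one_le_pow₀ (by exact_mod_cast hℓ)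
  nlinarith [mul_le_mul_of_nonneg_left h1 hq₀]

theorem isMassFunction_countMass {ℓ : ℕ} (hℓ : 1 ≤ ℓ) {γ q : ℝ} (hγ₀ : 0 < γ) (hγ : γ ≤ 1 / 2)
    (hq₀ : 0 ≤ q) (hq : 16 * q * (ℓ : ℝ) ^ 2 ≤ 1) (a : Prop) (s t : Fin n) :
    IsMassFunction (pairsBetween π s t).ncard (countMass ℓ γ q a π s t) := by
  have hq' := le_one_div_sixteen hℓ hq₀ hq
  rw [ncard_pairsBetween, countMass]
  split_ifs with h1 h2 h3
  · exact isMassFunction_binomialMass hq₀ (by linarith) _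
  · rw [blockSize, if_neg h1]
    exact isMassFunction_massP hγ₀ hγ hq₀ hq' (blockSize_mul_le hq₀ hq h2.1 h2.2)
  · rw [blockSize, if_neg h1]
    exact isMassFunction_massQ hγ₀ hγ hq₀ hq' (blockSize_mul_le hq₀ hq h2.1 h2.2)
  · exact isMassFunction_binomialMass hq₀ (by linarith) _

theorem isProbabilityMeasure_edgeBlockLaw {ℓ : ℕ} (hℓ : 1 ≤ ℓ) {γ q : ℝ} (hγ₀ : 0 < γ)
    (hγ : γ ≤ 1 / 2) (hq₀ : 0 ≤ q) (hq : 16 * q * (ℓ : ℝ) ^ 2 ≤ 1) (A : SimpleGraph (Fin n))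
    (s t : Fin n) : IsProbabilityMeasure (edgeBlockLaw ℓ γ q A π s t) := by
  rw [edgeBlockLaw, edgeCountLaw_eq]
  exact isProbabilityMeasure_block (isMassFunction_countMass hℓ hγ₀ hγ hq₀ hq _ s t)

theorem edgeBlockLaw_real {ℓ : ℕ} (hℓ : 1 ≤ ℓ) {γ q : ℝ} (hγ₀ : 0 < γ)
    (hγ : γ ≤ 1 / 2) (hq₀ : 0 ≤ q) (hq : 16 * q * (ℓ : ℝ) ^ 2 ≤ 1) (A : SimpleGraph (Fin n))
    (s t : Fin n) (F : Set (Sym2 (Fin N))) : (edgeBlockLaw ℓ γ q A π s t).real {F} =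
      blockMass (pairsBetween π s t) (countMass ℓ γ q (A.Adj s t) π s t) F := by
  rw [edgeBlockLaw, edgeCountLaw_eq]
  exact block_real (isMassFunction_countMass hℓ hγ₀ hγ hq₀ hq _ s t) F

end Reduction

/-! ### Graphs with independent edges -/

/-- The possible edges of a graph on `V`. -/
noncomputable def edges (V : Type*) [Fintype V] : Finset (Sym2 V) :=
  Finset.univ.filter fun e => ¬ e.IsDiag

/-- The mass function of the graph with independent edges, `e` having probability `w e`. -/
noncomputable def edgeProd {V : Type*} [Fintype V] (w : Sym2 V → ℝ) (G : SimpleGraph V) : ℝ :=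
  ∏ e ∈ edges V, bernoulliMass (w e) (e ∈ G.edgeSet)

section Edges

variable {V : Type*} [Fintype V]

theorem mem_edges {e : Sym2 V} : e ∈ edges V ↔ ¬ e.IsDiag := by
  simp [edges]

/-- Graphs on `V` are the subsets of `edges V`; expanding the product of sums picks `True` on such a
subset and `False` on its complement. -/
theorem sum_graph_prod [DecidableEq V] (h : Sym2 V → Prop → ℝ) :
    ∑ G : SimpleGraph V, ∏ e ∈ edges V, h e (e ∈ G.edgeSet) =
      ∏ e ∈ edges V, (h e True + h e False) := by
  rw [Finset.prod_add]
  refine Finset.sum_bij' (fun G _ => (edges V).filter (· ∈ G.edgeSet))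
    (fun t _ => SimpleGraph.fromEdgeSet (t : Set (Sym2 V))) ?_ ?_ ?_ ?_ ?_
  · intro G _
    simp
  · intro t _
    simp
  · intro G _
    refine SimpleGraph.edgeSet_injective ?_
    ext e
    simp only [SimpleGraph.edgeSet_fromEdgeSet, Finset.coe_filter, mem_edges, Set.mem_sdiff,
      Set.mem_ofPred_eq, Sym2.mem_diagSet]
    exact ⟨fun h => h.1.2, fun h => ⟨⟨G.not_isDiag_of_mem_edgeSet h, h⟩,
      G.not_isDiag_of_mem_edgeSet h⟩⟩
  · intro t ht
    ext e
    rw [Finset.mem_powerset] at ht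
    simp only [SimpleGraph.edgeSet_fromEdgeSet, Finset.mem_filter, mem_edges, Set.mem_sdiff,
      Finset.mem_coe, Sym2.mem_diagSet]
    exact ⟨fun h => h.2.1, fun h => ⟨mem_edges.1 (ht h), h, mem_edges.1 (ht h)⟩⟩
  · intro G _
    have h1 : edges V \ (edges V).filter (· ∈ G.edgeSet) =
        (edges V).filter (¬ · ∈ G.edgeSet) := by
      rw [Finset.filter_not]
    rw [h1, ← Finset.prod_filter_mul_prod_filter_not (edges V) (· ∈ G.edgeSet)]
    congr 1
    · refine Finset.prod_congr rfl fun e he => ?_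
      rw [eq_true (Finset.mem_filter.1 he).2]
    · refine Finset.prod_congr rfl fun e he => ?_
      rw [eq_false (Finset.mem_filter.1 he).2]

theorem sum_edgeProd [DecidableEq V] (w : Sym2 V → ℝ) : ∑ G, edgeProd w G = 1 := by
  refine (sum_graph_prod fun e x => bernoulliMass (w e) x).trans ?_
  simp

theorem edgeProd_nonneg {w : Sym2 V → ℝ} (hw : ∀ e, 0 ≤ w e ∧ w e ≤ 1) (G : SimpleGraph V) :
    0 ≤ edgeProd w G := by
  exact Finset.prod_nonneg fun e _ => bernoulliMass_nonneg (hw e).1 (hw e).2 _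

end Edges

theorem erdosRenyi_real (N : ℕ) {q : ℝ} (h₀ : 0 ≤ q) (h₁ : q ≤ 1) (G : SimpleGraph (Fin N)) :
    (erdosRenyi N q).real {G} = edgeProd (fun _ => q) G := by
  have h1 : ((edges (Fin N)).filter (· ∈ G.edgeSet)).card = G.edgeSet.ncard := by
    rw [Set.ncard_eq_toFinset_card']
    congr 1
    ext e
    simpa [mem_edges] using fun h => G.not_isDiag_of_mem_edgeSet h
  have h2 : (edges (Fin N)).card = N.choose 2 := by
    rw [edges, ← Fintype.card_subtype, Sym2.card_subtype_not_diag, Fintype.card_fin]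
  have h3 : ((edges (Fin N)).filter (¬ · ∈ G.edgeSet)).card = N.choose 2 - G.edgeSet.ncard := by
    rw [← h1, ← h2, Finset.filter_not, Finset.card_sdiff_of_subset (Finset.filter_subset _ _)]
  rw [edgeProd, prod_bernoulliMass _ _ fun e => e ∈ G.edgeSet, h1, h3, erdosRenyi,
    measureReal_def, SimpleGraph.binomialRandom_singleton]
  simp [prob_coe h₀ h₁]

theorem bernoulliMeasure_real {x : ℝ} (h₀ : 0 ≤ x) (h₁ : x ≤ 1) (y : Prop) :
    (bernoulliMeasure True False (prob x)).real {y} = bernoulliMass x y := by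
  rw [bernoulliMeasure_real_apply _ MeasurableSet.of_discrete]
  by_cases hy : y <;> simp [hy, prob_coe h₀ h₁]

instance (x y : Prop) (p : unitInterval) : IsProbabilityMeasure (bernoulliMeasure x y p) :=
  ⟨bernoulliMeasure_apply_of_mem_of_mem p .univ trivial trivial⟩

theorem independentEdges_real (N : ℕ) {w : Sym2 (Fin N) → ℝ} (hw : ∀ e, 0 ≤ w e ∧ w e ≤ 1)
    (G : SimpleGraph (Fin N)) : (independentEdges N w).real {G} = edgeProd w G := by
  rw [independentEdges, map_real _ _ (measurableSet_singleton G)]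
  -- The event factorises over `e`. Diagonal pairs, which `fromEdgeSet` discards, are unconstrained,
  -- so their factors sum to one.
  have h1 : ∀ f : Sym2 (Fin N) → Prop,
      (if SimpleGraph.fromEdgeSet {e | f e} ∈ ({G} : Set (SimpleGraph (Fin N))) then
        (Measure.pi fun e => bernoulliMeasure True False (prob (w e))).real {f} else 0) =
      ∏ e, if ¬ e.IsDiag → (f e ↔ e ∈ G.edgeSet) then (bernoulliMass (w e) (f e)) else 0 := by
    intro f
    have h2 : SimpleGraph.fromEdgeSet {e | f e} ∈ ({G} : Set (SimpleGraph (Fin N))) ↔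
        ∀ e : Sym2 (Fin N), ¬ e.IsDiag → (f e ↔ e ∈ G.edgeSet) := by
      rw [Set.mem_singleton_iff, ← SimpleGraph.edgeSet_inj, SimpleGraph.edgeSet_fromEdgeSet,
        Set.ext_iff]
      refine forall_congr' fun e => ?_
      have := G.not_isDiag_of_mem_edgeSet (e := e)
      simp only [Set.mem_sdiff, Set.mem_ofPred_eq, Sym2.mem_diagSet]
      tauto
    by_cases h3 : ∀ e : Sym2 (Fin N), ¬ e.IsDiag → (f e ↔ e ∈ G.edgeSet)
    · rw [if_pos (h2.2 h3), pi_real]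
      refine Finset.prod_congr rfl fun e _ => ?_
      rw [if_pos (h3 e), bernoulliMeasure_real (hw e).1 (hw e).2]
    · rw [if_neg (mt h2.1 h3)]
      obtain ⟨e, he⟩ := not_forall.1 h3
      exact (Finset.prod_eq_zero (Finset.mem_univ e) (if_neg he)).symm
  refine (Finset.sum_congr rfl fun f _ => (by convert h1 f)).trans ?_
  have h2 := Finset.prod_univ_sum (fun _ : Sym2 (Fin N) => (Finset.univ : Finset Prop))
    fun e y => if ¬ e.IsDiag → (y ↔ e ∈ G.edgeSet) then bernoulliMass (w e) y else 0
  rw [Fintype.piFinset_univ] at h2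
  rw [← h2, edgeProd, edges, Finset.prod_filter]
  refine Finset.prod_congr rfl fun e _ => ?_
  rw [Fintype.sum_Prop]
  by_cases he : e.IsDiag <;> by_cases hG : e ∈ G.edgeSet <;> simp [he, hG]

instance (N : ℕ) (w : Sym2 (Fin N) → ℝ) : IsProbabilityMeasure (independentEdges N w) :=
  Measure.isProbabilityMeasure_map Measurable.of_discrete.aemeasurable

instance (N : ℕ) (q : ℝ) : IsProbabilityMeasure (erdosRenyi N q) :=
  inferInstanceAs (IsProbabilityMeasure (SimpleGraph.binomialRandom _ _))

theorem setBernoulli_real {N : ℕ} {x : ℝ} (h₀ : 0 ≤ x) (h₁ : x ≤ 1) (S : Set (Fin N)) :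
    (setBernoulli (Set.univ : Set (Fin N)) (prob x)).real {S} =
      ∏ v, bernoulliMass x (v ∈ S) := by
  rw [setBernoulli_real_singleton _ (Set.subset_univ S) Set.finite_univ, prob_coe h₀ h₁,
    prod_bernoulliMass, Set.ncard_eq_toFinset_card',
    Set.ncard_eq_toFinset_card']
  congr 3
  · ext; simp
  · ext; simp

/-- The edge probabilities of the planted dense subgraph model, given the set `S`. -/
noncomputable def denseWeight {V : Type*} (p q : ℝ) (S : Set V) (e : Sym2 V) : ℝ :=
  if ∀ v ∈ e, v ∈ S then p else q

theorem plantedDense_real {N K : ℕ} {p q : ℝ} (hK : K ≤ N) (hp₀ : 0 ≤ p) (hp : p ≤ 1)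
    (hq₀ : 0 ≤ q) (hq : q ≤ 1) (G : SimpleGraph (Fin N)) :
    (plantedDense N K p q).real {G} =
      ∑ S : Set (Fin N), (∏ v, bernoulliMass ((K : ℝ) / N) (v ∈ S)) *
        edgeProd (denseWeight p q S) G := by
  rw [plantedDense, bind_real _ _ (measurableSet_singleton G)]
  refine Finset.sum_congr rfl fun S _ => ?_
  rw [setBernoulli_real (by positivity) (div_le_one_of_le₀ (by exact_mod_cast hK) (by positivity)),
    independentEdges_real]
  · congr!
    rw [denseWeight]
    congr
  · intro e
    split_ifs <;> constructor <;> assumption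

/-! ### The mass function of the reduction -/

/-- The blocks of the reduction. -/
abbrev Block (n : ℕ) : Type := {b : Fin n × Fin n // b.1 ≤ b.2}

/-- The possible edges of a block. -/
abbrev blockEdges {N n : ℕ} (π : Fin N → Fin n) (b : Block n) : Set (Sym2 (Fin N)) :=
  pairsBetween π b.1.1 b.1.2

/-- The block of a possible edge. -/
def blockOf {N n : ℕ} (π : Fin N → Fin n) (e : Sym2 (Fin N)) : Block n :=
  Sym2.sortEquiv (e.map π)

/-- The mass function of the graph whose edges are drawn block by block, independently, where the
number of edges of the block `b` has mass function `f b`. -/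
noncomputable def graphMass {N n : ℕ} (π : Fin N → Fin n) (f : Block n → ℕ → ℝ)
    (G : SimpleGraph (Fin N)) : ℝ :=
  ∏ b, blockMass (blockEdges π b) (f b) (G.edgeSet ∩ blockEdges π b)

section Blocks

variable {N n : ℕ} {π : Fin N → Fin n}

theorem mem_blockEdges_iff {b : Block n} {e : Sym2 (Fin N)} :
    e ∈ blockEdges π b ↔ e ∈ edges (Fin N) ∧ blockOf π e = b := by
  rw [mem_pairsBetween_iff, mem_edges, blockOf, ← Equiv.eq_symm_apply]
  rfl

theorem iUnion_edgeSet_inter_blockEdges (G : SimpleGraph (Fin N)) :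
    ⋃ b, (G.edgeSet ∩ blockEdges π b) = G.edgeSet := by
  ext e
  simp only [Set.mem_iUnion, Set.mem_inter_iff, mem_blockEdges_iff, mem_edges]
  exact ⟨fun ⟨_, h, _⟩ => h, fun h => ⟨_, h, G.not_isDiag_of_mem_edgeSet h, rfl⟩⟩

theorem injective_edgeSet_inter_blockEdges (π : Fin N → Fin n) :
    Function.Injective fun (G : SimpleGraph (Fin N)) (b : Block n) =>
      G.edgeSet ∩ blockEdges π b := by
  intro G H h
  refine SimpleGraph.edgeSet_injective ?_
  rw [← iUnion_edgeSet_inter_blockEdges (π := π) G, ← iUnion_edgeSet_inter_blockEdges (π := π) H]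
  exact Set.iUnion_congr fun b => congrFun h b

theorem edgeSet_inter_blockEdges_of_fromEdgeSet {F : Block n → Set (Sym2 (Fin N))}
    (hF : ∀ b, F b ⊆ blockEdges π b) {G : SimpleGraph (Fin N)}
    (h : SimpleGraph.fromEdgeSet (⋃ b, F b) = G) :
    F = fun b => G.edgeSet ∩ blockEdges π b := by
  subst h
  ext b e
  simp only [SimpleGraph.edgeSet_fromEdgeSet, Set.mem_inter_iff, Set.mem_sdiff, Set.mem_iUnion,
    Sym2.mem_diagSet]
  constructor
  · intro he
    have := mem_blockEdges_iff.1 (hF b he)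
    exact ⟨⟨⟨b, he⟩, mem_edges.1 this.1⟩, hF b he⟩
  · rintro ⟨⟨⟨b', he⟩, -⟩, hb⟩
    rwa [← (mem_blockEdges_iff.1 hb).2, (mem_blockEdges_iff.1 (hF b' he)).2]

/-- Every possible edge lies in exactly one block, so a family contained in its blocks is recovered
from its union; all other families have mass zero. -/
theorem sum_blockMass_eq_graphMass (f : Block n → ℕ → ℝ) (G : SimpleGraph (Fin N)) :
    (∑ F : Block n → Set (Sym2 (Fin N)), if SimpleGraph.fromEdgeSet (⋃ b, F b) = G then
      ∏ b, blockMass (blockEdges π b) (f b) (F b) else 0) = graphMass π f G := by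
  rw [Finset.sum_eq_single fun b => G.edgeSet ∩ blockEdges π b, if_pos, graphMass]
  · rw [iUnion_edgeSet_inter_blockEdges, SimpleGraph.fromEdgeSet_edgeSet]
  · intro F _ hF
    split_ifs with h
    · have : ∃ b, ¬ F b ⊆ blockEdges π b := by
        by_contra h2
        exact hF (edgeSet_inter_blockEdges_of_fromEdgeSet
          (fun b => not_not.1 (not_exists.1 h2 b)) h)
      obtain ⟨b, hb⟩ := this
      exact Finset.prod_eq_zero (Finset.mem_univ b) (by rw [blockMass, if_neg hb])
    · rfl
  · simp

/-- The blocks partition the possible edges, and inside each block the edges are independent. -/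
theorem graphMass_binomialMass {r : Block n → ℝ} (hr : ∀ b, 0 ≤ r b ∧ r b ≤ 1)
    (G : SimpleGraph (Fin N)) :
    graphMass π (fun b => binomialMass (blockEdges π b).ncard (r b)) G =
      edgeProd (fun e => r (blockOf π e)) G := by
  rw [edgeProd, graphMass, ← Finset.prod_fiberwise (edges (Fin N)) (blockOf π)]
  refine Finset.prod_congr rfl fun b _ => ?_
  rw [blockMass_binomialMass (hr b).1 (hr b).2 Set.inter_subset_right]
  have h : Finset.univ.filter (· ∈ blockEdges π b) =
      (edges (Fin N)).filter (blockOf π · = b) := by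
    ext e
    rw [Finset.mem_filter_univ, mem_blockEdges_iff, Finset.mem_filter]
  rw [h]
  refine Finset.prod_congr rfl fun e he => ?_
  have he := Finset.mem_filter.1 he
  have h2 : (e ∈ G.edgeSet ∩ blockEdges π b) = (e ∈ G.edgeSet) :=
    propext ⟨fun h => h.1, fun h => ⟨h, mem_blockEdges_iff.2 he⟩⟩
  rw [he.2, h2]

end Blocks

/-! ### Distances of product laws. -/

theorem sum_pi_prod {ι : Type*} [Fintype ι] [DecidableEq ι] {X : ι → Type*} [∀ i, Fintype (X i)]
    (f : ∀ i, X i → ℝ) : ∑ x : ∀ i, X i, ∏ i, f i (x i) = ∏ i, ∑ y, f i y := by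
  rw [Finset.prod_univ_sum, Fintype.piFinset_univ]

/-- The `ℓ¹` distance of product laws is at most the sum of the `ℓ¹` distances of the factors. -/
theorem sum_abs_prod_sub_le {ι : Type*} [Fintype ι] [DecidableEq ι] {X : ι → Type*}
    [∀ i, Fintype (X i)]
    (f g : ∀ i, X i → ℝ) (hf : ∀ i x, 0 ≤ f i x) (hg : ∀ i x, 0 ≤ g i x)
    (hf₁ : ∀ i, ∑ x, f i x = 1) (hg₁ : ∀ i, ∑ x, g i x = 1) :
    ∑ x : ∀ i, X i, |∏ i, f i (x i) - ∏ i, g i (x i)| ≤ ∑ i, ∑ y, |f i y - g i y| := by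
  -- Hybrid argument: the coordinates in `s` have been switched from `f` to `g`, and switching one
  -- more costs the distance of that factor alone.
  have key : ∀ s : Finset ι, ∑ x : ∀ i, X i,
      |∏ i, f i (x i) - ∏ i, (if i ∈ s then g i (x i) else f i (x i))| ≤
        ∑ i ∈ s, ∑ y, |f i y - g i y| := by
    intro s
    induction s using Finset.induction_on with
    | empty => simp
    | insert a s ha ih =>
      rw [Finset.sum_insert ha]
      have h1 : ∀ x : ∀ i, X i,
          |∏ i, (if i ∈ s then g i (x i) else f i (x i)) -
            ∏ i, (if i ∈ insert a s then g i (x i) else f i (x i))| =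
          ∏ i, if i = a then |f i (x i) - g i (x i)| else
            if i ∈ s then g i (x i) else f i (x i) := by
        intro x
        rw [← Finset.mul_prod_erase _ _ (Finset.mem_univ a),
          ← Finset.mul_prod_erase (a := a) _ (fun i => if i ∈ insert a s then _ else _)
            (Finset.mem_univ a),
          ← Finset.mul_prod_erase (a := a) _ (fun i => if i = a then _ else _)
            (Finset.mem_univ a)]
        simp only [if_neg ha, Finset.mem_insert_self, if_true]
        have h2 : ∏ i ∈ Finset.univ.erase a,
            (if i ∈ insert a s then g i (x i) else f i (x i)) =
            ∏ i ∈ Finset.univ.erase a, (if i ∈ s then g i (x i) else f i (x i)) := by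
          refine Finset.prod_congr rfl fun i hi => ?_
          simp [Finset.mem_insert, (Finset.mem_erase.1 hi).1]
        have h3 : ∏ i ∈ Finset.univ.erase a, (if i = a then |f i (x i) - g i (x i)| else
              if i ∈ s then g i (x i) else f i (x i)) =
            ∏ i ∈ Finset.univ.erase a, (if i ∈ s then g i (x i) else f i (x i)) := by
          refine Finset.prod_congr rfl fun i hi => ?_
          simp [(Finset.mem_erase.1 hi).1]
        rw [h2, h3, ← sub_mul, abs_mul]
        congr 1
        refine abs_of_nonneg (Finset.prod_nonneg fun i _ => ?_)
        split_ifs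
        exacts [hg _ _, hf _ _]
      have h2 : ∑ x : ∀ i, X i,
          |∏ i, (if i ∈ s then g i (x i) else f i (x i)) -
            ∏ i, (if i ∈ insert a s then g i (x i) else f i (x i))| =
          ∑ y, |f a y - g a y| := by
        rw [Finset.sum_congr rfl fun x _ => h1 x]
        refine (sum_pi_prod fun i y => if i = a then |f i y - g i y| else
            if i ∈ s then g i y else f i y).trans ?_
        rw [Finset.prod_eq_single a]
        · simp
        · intro i _ hi
          simp only [if_neg hi]
          split_ifs
          exacts [hg₁ i, hf₁ i]
        · simp
      calc _ ≤ ∑ x : ∀ i, X i,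
            (|∏ i, f i (x i) - ∏ i, (if i ∈ s then g i (x i) else f i (x i))| +
              |∏ i, (if i ∈ s then g i (x i) else f i (x i)) -
                ∏ i, (if i ∈ insert a s then g i (x i) else f i (x i))|) :=
            Finset.sum_le_sum fun x _ => abs_sub_le _ _ _
        _ ≤ _ := by
            rw [Finset.sum_add_distrib, h2]
            linarith
  simpa using key Finset.univ

section GraphMass

variable {N n : ℕ} {π : Fin N → Fin n}

theorem graphMass_nonneg {f : Block n → ℕ → ℝ}
    (hf : ∀ b, IsMassFunction (blockEdges π b).ncard (f b)) (G : SimpleGraph (Fin N)) :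
    0 ≤ graphMass π f G :=
  Finset.prod_nonneg fun b _ => blockMass_nonneg (hf b) _

/-- Cutting a graph into blocks is injective, so the sum over graphs is part of the sum over all
families of edge sets, where the bound for product laws applies. -/
theorem sum_abs_graphMass_sub_le {f g : Block n → ℕ → ℝ}
    (hf : ∀ b, IsMassFunction (blockEdges π b).ncard (f b))
    (hg : ∀ b, IsMassFunction (blockEdges π b).ncard (g b)) :
    ∑ G : SimpleGraph (Fin N), |graphMass π f G - graphMass π g G| ≤
      ∑ b, ∑ m ∈ Finset.range ((blockEdges π b).ncard + 1), |f b m - g b m| := by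
  have h := sum_abs_prod_sub_le (fun b : Block n => blockMass (blockEdges π b) (f b))
    (fun b => blockMass (blockEdges π b) (g b)) (fun b => blockMass_nonneg (hf b))
    (fun b => blockMass_nonneg (hg b)) (fun b => by rw [sum_blockMass]; exact (hf b).2)
    (fun b => by rw [sum_blockMass]; exact (hg b).2)
  simp_rw [sum_abs_blockMass_sub] at h
  refine le_trans ?_ h
  simp only [graphMass]
  exact (Finset.sum_image (f := fun F : Block n → Set (Sym2 (Fin N)) =>
      |∏ b, blockMass (blockEdges π b) (f b) (F b) -
        ∏ b, blockMass (blockEdges π b) (g b) (F b)|)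
      ((injective_edgeSet_inter_blockEdges π).injOn)).symm.le.trans
    (Finset.sum_le_sum_of_subset_of_nonneg (Finset.subset_univ _) fun _ _ _ => abs_nonneg _)

end GraphMass

/-! ### The laws of the parents and of the output. -/

section Law

variable {ℓ n : ℕ} {γ q : ℝ}

theorem isProbabilityMeasure_parentLaw (N : ℕ) (hn : 1 ≤ n) :
    IsProbabilityMeasure (parentLaw N n) := by
  have : NeZero n := ⟨by omega⟩
  have : IsProbabilityMeasure (uniformOn (Set.univ : Set (Fin n))) :=
    isProbabilityMeasure_uniformOn Set.finite_univ Set.univ_nonempty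
  rw [parentLaw]
  infer_instance

theorem parentLaw_real {N : ℕ} (hn : 1 ≤ n) (π : Fin N → Fin n) :
    (parentLaw N n).real {π} = (1 / n : ℝ) ^ N := by
  have : NeZero n := ⟨by omega⟩
  have : IsProbabilityMeasure (uniformOn (Set.univ : Set (Fin n))) :=
    isProbabilityMeasure_uniformOn Set.finite_univ Set.univ_nonempty
  rw [parentLaw, pi_real]
  simp [uniformOn_real_singleton, Set.ncard_univ]

variable (hℓ : 1 ≤ ℓ) (hn : 1 ≤ n) (hγ₀ : 0 < γ) (hγ : γ ≤ 1 / 2) (hq₀ : 0 ≤ q)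
  (hq : 16 * q * (ℓ : ℝ) ^ 2 ≤ 1)

include hℓ hn hγ₀ hγ hq₀ hq

theorem isProbabilityMeasure_reduction (A : SimpleGraph (Fin n)) :
    IsProbabilityMeasure (reduction ℓ n γ q A) := by
  have := isProbabilityMeasure_parentLaw (ℓ * n) hn
  have := fun (π : Fin (ℓ * n) → Fin n) (b : Block n) =>
    isProbabilityMeasure_edgeBlockLaw (π := π) hℓ hγ₀ hγ hq₀ hq A b.1.1 b.1.2
  have := fun π : Fin (ℓ * n) → Fin n => Measure.isProbabilityMeasure_map
    (μ := Measure.pi fun b : Block n => edgeBlockLaw ℓ γ q A π b.1.1 b.1.2)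
    (f := fun F => SimpleGraph.fromEdgeSet (⋃ b, F b)) Measurable.of_discrete.aemeasurable
  exact isProbabilityMeasure_bind_of_discrete _ _

theorem reduction_real (A : SimpleGraph (Fin n)) (G : SimpleGraph (Fin (ℓ * n))) :
    (reduction ℓ n γ q A).real {G} = ∑ π : Fin (ℓ * n) → Fin n, (1 / n : ℝ) ^ (ℓ * n) *
      graphMass π (fun b => countMass ℓ γ q (A.Adj b.1.1 b.1.2) π b.1.1 b.1.2) G := by
  have := isProbabilityMeasure_parentLaw (ℓ * n) hn
  have := fun (π : Fin (ℓ * n) → Fin n) (b : Block n) =>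
    isProbabilityMeasure_edgeBlockLaw (π := π) hℓ hγ₀ hγ hq₀ hq A b.1.1 b.1.2
  have := fun π : Fin (ℓ * n) → Fin n => Measure.isProbabilityMeasure_map
    (μ := Measure.pi fun b : Block n => edgeBlockLaw ℓ γ q A π b.1.1 b.1.2)
    (f := fun F => SimpleGraph.fromEdgeSet (⋃ b, F b)) Measurable.of_discrete.aemeasurable
  rw [reduction, bind_real _ _ (measurableSet_singleton G)]
  refine Finset.sum_congr rfl fun π _ => ?_
  rw [parentLaw_real hn, map_real _ _ (measurableSet_singleton G), ← sum_blockMass_eq_graphMass]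
  congr 1
  refine Finset.sum_congr rfl fun F _ => ?_
  simp only [Set.mem_singleton_iff]
  congr 1
  rw [pi_real]
  exact Finset.prod_congr rfl fun b _ => edgeBlockLaw_real hℓ hγ₀ hγ hq₀ hq A _ _ _

end Law

/-! ### Averaging over the input graph -/

theorem mk_sortEquiv {α : Type*} [LinearOrder α] (z : Sym2 α) :
    s((Sym2.sortEquiv z).1.1, (Sym2.sortEquiv z).1.2) = z :=
  Sym2.sortEquiv.symm_apply_apply z

/-- Blocks with distinct ends correspond to the possible input edges, which are independent.
Diagonal blocks see no input edge; `hH` makes their average trivial. -/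
theorem sum_edgeProd_mul_prod_block {n : ℕ} (γ : ℝ) (H : Block n → Prop → ℝ)
    (hH : ∀ b : Block n, b.1.1 = b.1.2 → H b True = H b False) :
    ∑ A : SimpleGraph (Fin n), edgeProd (fun _ => γ) A * ∏ b, H b (A.Adj b.1.1 b.1.2) =
      ∏ b, (γ * H b True + (1 - γ) * H b False) := by
  have hdiag : ∀ z : Sym2 (Fin n), z.IsDiag ↔ (Sym2.sortEquiv z).1.1 = (Sym2.sortEquiv z).1.2 := by
    intro z
    rw [← Sym2.mk_isDiag_iff, mk_sortEquiv]
  have h1 : ∀ A : SimpleGraph (Fin n), ∏ b, H b (A.Adj b.1.1 b.1.2) =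
      (∏ z ∈ edges (Fin n), H (Sym2.sortEquiv z) (z ∈ A.edgeSet)) *
        ∏ z ∈ Finset.univ.filter fun z : Sym2 (Fin n) => ¬ ¬ z.IsDiag,
          H (Sym2.sortEquiv z) False := by
    intro A
    rw [← Sym2.sortEquiv.prod_comp, ← Finset.prod_filter_mul_prod_filter_not _ fun z => ¬ z.IsDiag]
    congr 1
    · refine Finset.prod_congr (by ext; simp [mem_edges]) fun z _ => ?_
      rw [← SimpleGraph.mem_edgeSet, mk_sortEquiv]
    · refine Finset.prod_congr rfl fun z hz => ?_
      have hz : z.IsDiag := by simpa using hz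
      rw [(hdiag z).1 hz]
      simp
  have h2 : ∏ b, (γ * H b True + (1 - γ) * H b False) =
      (∏ z ∈ edges (Fin n),
        (γ * H (Sym2.sortEquiv z) True + (1 - γ) * H (Sym2.sortEquiv z) False)) *
        ∏ z ∈ Finset.univ.filter fun z : Sym2 (Fin n) => ¬ ¬ z.IsDiag,
          H (Sym2.sortEquiv z) False := by
    rw [← Sym2.sortEquiv.prod_comp, ← Finset.prod_filter_mul_prod_filter_not _ fun z => ¬ z.IsDiag]
    congr 1
    · exact Finset.prod_congr (by ext; simp [mem_edges]) fun z _ => rfl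
    · refine Finset.prod_congr rfl fun z hz => ?_
      have hz : z.IsDiag := by simpa using hz
      rw [hH _ ((hdiag z).1 hz)]
      ring
  simp_rw [h1, ← mul_assoc]
  rw [h2, ← Finset.sum_mul]
  congr 1
  have h3 := sum_graph_prod fun (z : Sym2 (Fin n)) x =>
    bernoulliMass γ x * H (Sym2.sortEquiv z) x
  simp only [bernoulliMass_true, bernoulliMass_false] at h3
  rw [← h3]
  refine Finset.sum_congr rfl fun A _ => ?_
  rw [edgeProd, ← Finset.prod_mul_distrib]

/-- The conditional mass function of the number of edges of a block, after averaging over an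
Erdős–Rényi input graph to which all edges inside `C` are added. -/
noncomputable def meanMass {N n : ℕ} (ℓ : ℕ) (γ q : ℝ) (C : Set (Fin n)) (π : Fin N → Fin n)
    (b : Block n) : ℕ → ℝ :=
  if b.1.1 ≠ b.1.2 ∧ (b.1.1 ∈ C ∧ b.1.2 ∈ C) ∧
      childCount π b.1.1 ≤ 2 * ℓ ∧ childCount π b.1.2 ≤ 2 * ℓ then
    massP γ q (blockEdges π b).ncard
  else binomialMass (blockEdges π b).ncard q

/-- The mass function of the output of the reduction, when the input is an Erdős–Rényi graph to
which all edges inside `C` are added. -/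
noncomputable def cliqueMass (ℓ n : ℕ) (γ q : ℝ) (C : Set (Fin n))
    (G : SimpleGraph (Fin (ℓ * n))) : ℝ :=
  ∑ π : Fin (ℓ * n) → Fin n, (1 / n : ℝ) ^ (ℓ * n) * graphMass π (meanMass ℓ γ q C π) G

theorem cliqueOn_adj {V : Type*} {C : Set V} {s t : V} :
    (cliqueOn C).Adj s t ↔ s ≠ t ∧ s ∈ C ∧ t ∈ C := by
  simp only [cliqueOn, SimpleGraph.fromRel_adj]
  tauto

/-- Given the parents, each block depends on at most one input edge, so the average acts block by
block. Inside `C` the edge is always present and `P'` survives; outside, `P'` and `Q'` mix to `Q`;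
diagonal and oversized blocks have law `Q` anyway. -/
theorem sum_edgeProd_mul_graphMass {N n ℓ : ℕ} {γ q : ℝ} (hγ : γ ≤ 1 / 2) (C : Set (Fin n))
    (π : Fin N → Fin n) (G : SimpleGraph (Fin N)) :
    ∑ A : SimpleGraph (Fin n), edgeProd (fun _ => γ) A * graphMass π (fun b =>
      countMass ℓ γ q ((A ⊔ cliqueOn C).Adj b.1.1 b.1.2) π b.1.1 b.1.2) G =
        graphMass π (meanMass ℓ γ q C π) G := by
  have h1 := sum_edgeProd_mul_prod_block γ (fun (b : Block n) x =>
    blockMass (blockEdges π b) (countMass ℓ γ q (x ∨ (cliqueOn C).Adj b.1.1 b.1.2) π b.1.1 b.1.2)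
      (G.edgeSet ∩ blockEdges π b)) (fun b hb => by simp only [countMass, if_pos hb])
  simp only [graphMass, SimpleGraph.sup_adj]
  rw [h1]
  refine Finset.prod_congr rfl fun b _ => ?_
  simp only [blockMass, if_pos (Set.inter_subset_right), true_or, false_or]
  rw [← mul_div_assoc, ← mul_div_assoc, ← add_div]
  congr 1
  simp only [countMass, meanMass, cliqueOn_adj, ← ncard_pairsBetween, if_true]
  by_cases h2 : b.1.1 = b.1.2
  · rw [if_pos h2, if_pos h2, if_neg fun h => h.1 h2]
    ring
  · by_cases h3 : childCount π b.1.1 ≤ 2 * ℓ ∧ childCount π b.1.2 ≤ 2 * ℓ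
    · by_cases h4 : b.1.1 ∈ C ∧ b.1.2 ∈ C
      · simp only [h2, h3, h4, if_true, ne_eq, not_false_eq_true, and_self, if_false]
        ring
      · simp only [h2, h3, h4, if_true, ne_eq, not_false_eq_true, and_true, and_false, if_false]
        exact mix_mass hγ _
    · simp only [h2, h3, if_false, and_false]
      ring

section Law

variable {ℓ n : ℕ} {γ q : ℝ} (hℓ : 1 ≤ ℓ) (hn : 1 ≤ n) (hγ₀ : 0 < γ) (hγ : γ ≤ 1 / 2)
  (hq₀ : 0 ≤ q) (hq : 16 * q * (ℓ : ℝ) ^ 2 ≤ 1)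

include hℓ hn hγ₀ hγ hq₀ hq

theorem sum_erdosRenyi_mul_reduction (C : Set (Fin n)) (G : SimpleGraph (Fin (ℓ * n))) :
    ∑ A, (erdosRenyi n γ).real {A} * (reduction ℓ n γ q (A ⊔ cliqueOn C)).real {G} =
      cliqueMass ℓ n γ q C G := by
  simp_rw [reduction_real hℓ hn hγ₀ hγ hq₀ hq, erdosRenyi_real n hγ₀.le (by linarith : γ ≤ 1),
    Finset.mul_sum]
  rw [Finset.sum_comm, cliqueMass]
  refine Finset.sum_congr rfl fun π _ => ?_
  rw [← sum_edgeProd_mul_graphMass hγ, Finset.mul_sum]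
  exact Finset.sum_congr rfl fun A _ => by ring

/-- This is the case `C = ∅` of the averaged law: every block has law `Q`, whatever the parents are.
-/
theorem erdosRenyi_bind_reduction :
    (erdosRenyi n γ).bind (reduction ℓ n γ q) = erdosRenyi (ℓ * n) q := by
  have := isProbabilityMeasure_reduction hℓ hn hγ₀ hγ hq₀ hq
  have := isProbabilityMeasure_bind_of_discrete (erdosRenyi n γ) (reduction ℓ n γ q)
  have hq' := le_one_div_sixteen hℓ hq₀ hq
  refine Measure.ext_of_measureReal_singleton fun G => ?_
  have h1 := sum_erdosRenyi_mul_reduction hℓ hn hγ₀ hγ hq₀ hq ∅ G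
  have h2 : cliqueOn (∅ : Set (Fin n)) = ⊥ := by
    ext s t
    simp [cliqueOn_adj]
  simp only [h2, sup_bot_eq] at h1
  rw [bind_real _ _ (measurableSet_singleton G), h1, erdosRenyi_real _ hq₀ (by linarith),
    cliqueMass]
  have h3 : ∀ π : Fin (ℓ * n) → Fin n, graphMass π (meanMass ℓ γ q ∅ π) G =
      edgeProd (fun _ => q) G := by
    intro π
    rw [← graphMass_binomialMass (π := π) (r := fun _ => q) fun _ => ⟨hq₀, by linarith⟩]
    congr 1
    ext1 b
    simp [meanMass]
  have h4 : (n : ℝ) ≠ 0 := Nat.cast_ne_zero.2 (by omega)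
  rw [Finset.sum_congr rfl fun π _ => by rw [h3 π], Finset.sum_const, nsmul_eq_mul, ← mul_assoc,
    Finset.card_univ, Fintype.card_fun, Fintype.card_fin, Fintype.card_fin, Nat.cast_pow,
    ← mul_pow, mul_one_div_cancel h4, one_pow, one_mul]

/-- Conditioning on the clique, which is independent of the Erdős–Rényi graph. -/
theorem plantedClique_bind_reduction_real {k : ℕ} (hk : k ≤ n) (G : SimpleGraph (Fin (ℓ * n))) :
    ((plantedClique n k γ).bind (reduction ℓ n γ q)).real {G} =
      ∑ C, (uniformOn {C : Set (Fin n) | C.ncard = k}).real {C} * cliqueMass ℓ n γ q C G := by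
  have := isProbabilityMeasure_reduction hℓ hn hγ₀ hγ hq₀ hq
  have hne : {C : Set (Fin n) | C.ncard = k}.Nonempty := by
    obtain ⟨C, -, hC⟩ := Set.exists_subset_card_eq (s := (Set.univ : Set (Fin n))) (n := k)
      (by simpa [Set.ncard_univ] using hk)
    exact ⟨C, hC⟩
  have := isProbabilityMeasure_uniformOn (Set.toFinite _) hne
  have hpc : IsProbabilityMeasure (plantedClique n k γ) :=
    Measure.isProbabilityMeasure_map Measurable.of_discrete.aemeasurable
  rw [bind_real _ _ (measurableSet_singleton G)]
  have h1 : ∀ A, (plantedClique n k γ).real {A} = ∑ x : SimpleGraph (Fin n) × Set (Fin n),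
      if x.1 ⊔ cliqueOn x.2 = A then (erdosRenyi n γ).real {x.1} *
        (uniformOn {C : Set (Fin n) | C.ncard = k}).real {x.2} else 0 := by
    intro A
    rw [plantedClique, map_real _ _ (measurableSet_singleton A)]
    refine Finset.sum_congr rfl fun x _ => ?_
    rw [← measureReal_prod_prod, Set.singleton_prod_singleton]
    simp
  simp_rw [h1, Finset.sum_mul]
  rw [Finset.sum_comm, Fintype.sum_prod_type_right]
  refine Finset.sum_congr rfl fun C _ => ?_
  rw [← sum_erdosRenyi_mul_reduction hℓ hn hγ₀ hγ hq₀ hq, Finset.mul_sum]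
  refine Finset.sum_congr rfl fun A _ => ?_
  simp only [ite_mul, zero_mul, Finset.sum_ite_eq, Finset.mem_univ, if_true]
  ring

end Law

/-! ### The collision sum of two parent maps -/

/-- A sum over sequences, with interactions between all pairs of positions, is bounded by adding
one position at a time. -/
theorem sum_interaction_le {X : Type*} [Fintype X] (ρ : X → ℝ) (h : X → X → ℝ) (c : ℝ)
    (hρ : ∀ x, 0 ≤ ρ x) (hh : ∀ x y, 0 ≤ h x y) (hc : 0 ≤ c)
    (good : ∀ N : ℕ, (Fin N → X) → Prop)
    (hgood : ∀ N x (f : Fin N → X), good (N + 1) (Fin.cons x f) → good N f)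
    (hstep : ∀ N (f : Fin N → X), good N f → ∑ x, ρ x * ∏ v, h x (f v) ≤ c) (N : ℕ) :
    ∑ f : Fin N → X, (if good N f then (∏ v, ρ (f v)) *
      ∏ u, ∏ v, (if u < v then h (f u) (f v) else 1) else 0) ≤ c ^ N := by
  induction N with
  | zero =>
    rw [Fintype.sum_unique]
    split_ifs <;> simp
  | succ N ih =>
    rw [← (Fin.consEquiv fun _ => X).sum_comp, Fintype.sum_prod_type_right]
    -- If the tail `f` is good, the factors involving the new head split off and are bounded by
    -- `hstep`; if it is not, `hgood` makes every term vanish.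
    have key : ∀ f : Fin N → X, ∑ x, (if good (N + 1) (Fin.consEquiv (fun _ => X) (x, f)) then
        (∏ v, ρ (Fin.consEquiv (fun _ => X) (x, f) v)) *
          ∏ u, ∏ v, (if u < v then h (Fin.consEquiv (fun _ => X) (x, f) u)
            (Fin.consEquiv (fun _ => X) (x, f) v) else 1) else 0) ≤
        (if good N f then (∏ v, ρ (f v)) *
          ∏ u, ∏ v, (if u < v then h (f u) (f v) else 1) else 0) * c := by
      intro f
      have hnn : 0 ≤ (∏ v, ρ (f v)) * ∏ u, ∏ v, (if u < v then h (f u) (f v) else 1) := by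
        refine mul_nonneg (Finset.prod_nonneg fun v _ => hρ _)
          (Finset.prod_nonneg fun u _ => Finset.prod_nonneg fun v _ => ?_)
        split_ifs
        exacts [hh _ _, zero_le_one]
      by_cases hf : good N f
      · rw [if_pos hf]
        refine le_trans ?_ (mul_le_mul_of_nonneg_left (hstep N f hf) hnn)
        rw [Finset.mul_sum]
        refine Finset.sum_le_sum fun x _ => ?_
        have h1 : (∏ v, ρ (Fin.consEquiv (fun _ => X) (x, f) v)) *
            ∏ u, ∏ v, (if u < v then h (Fin.consEquiv (fun _ => X) (x, f) u)
              (Fin.consEquiv (fun _ => X) (x, f) v) else 1) =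
            (∏ v, ρ (f v)) * (∏ u, ∏ v, (if u < v then h (f u) (f v) else 1)) *
              (ρ x * ∏ v, h x (f v)) := by
          simp only [Fin.consEquiv_apply, Fin.prod_univ_succ, Fin.cons_zero, Fin.cons_succ,
            Fin.succ_lt_succ_iff, Fin.succ_pos, if_true, if_false, Fin.not_lt_zero,
            one_mul]
          ring
        rw [h1]
        split_ifs
        · exact le_rfl
        · exact mul_nonneg hnn (mul_nonneg (hρ x) (Finset.prod_nonneg fun v _ => hh _ _))
      · rw [if_neg hf, zero_mul]
        refine (Finset.sum_eq_zero fun x _ => if_neg fun h2 => hf (hgood N x f h2)).le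
    calc _ ≤ ∑ f : Fin N → X, (if good N f then (∏ v, ρ (f v)) *
          ∏ u, ∏ v, (if u < v then h (f u) (f v) else 1) else 0) * c :=
          Finset.sum_le_sum fun f _ => key f
      _ = (∑ f : Fin N → X, (if good N f then (∏ v, ρ (f v)) *
          ∏ u, ∏ v, (if u < v then h (f u) (f v) else 1) else 0)) * c := by rw [Finset.sum_mul]
      _ ≤ c ^ N * c := mul_le_mul_of_nonneg_right ih hc
      _ = c ^ (N + 1) := (pow_succ c N).symm

/-- `(1 + x)^m ≤ exp(m x) ≤ 1 + 2 m x`; this linearises the product of the collision factors. -/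
theorem one_add_pow_le {x : ℝ} (hx : 0 ≤ x) {m : ℕ} (h : 2 * (m * x) ≤ 1) :
    (1 + x) ^ m ≤ 1 + 2 * x * m := by
  have h2 := (abs_le.1 (Real.abs_exp_sub_one_le (x := m * x)
    (by rw [abs_of_nonneg (by positivity)]; linarith))).2
  rw [abs_of_nonneg (by positivity)] at h2
  calc (1 + x) ^ m ≤ Real.exp x ^ m := by
        refine pow_le_pow_left₀ (by linarith) ?_ m
        linarith [Real.add_one_le_exp x]
    _ = Real.exp (m * x) := (Real.exp_nat_mul x m).symm
    _ ≤ _ := by linarith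

/-- The law of the parents of a vertex in two copies of the model that are conditionally
independent, given whether the parent lies in `C`. -/
noncomputable def coupledMass {n : ℕ} (C : Set (Fin n)) (x : Fin n × Fin n) : ℝ :=
  if x.1 ∈ C ↔ x.2 ∈ C then
    (1 / n : ℝ) ^ 2 / bernoulliMass ((C.ncard : ℝ) / n) (x.1 ∈ C) else 0

section Collision

variable {n : ℕ} {C : Set (Fin n)}

theorem ncard_div_nonneg (C : Set (Fin n)) : 0 ≤ (C.ncard : ℝ) / n := by positivity

theorem ncard_div_le_one (C : Set (Fin n)) : (C.ncard : ℝ) / n ≤ 1 := by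
  refine div_le_one_of_le₀ ?_ (by positivity)
  have := Set.ncard_le_card C
  rw [Nat.card_eq_fintype_card, Fintype.card_fin] at this
  exact_mod_cast this

theorem sum_ite_mem (C : Set (Fin n)) : ∑ y, (if y ∈ C then (1 : ℝ) else 0) = C.ncard := by
  rw [Finset.sum_boole, Set.ncard_eq_toFinset_card']
  congr 2
  ext
  simp

/-- The probability that a uniform vertex lies in `C`, or in its complement. -/
theorem sum_iff_mem (hn : 1 ≤ n) (C : Set (Fin n)) (x : Prop) :
    ∑ y, (if x ↔ y ∈ C then (1 / n : ℝ) else 0) = bernoulliMass ((C.ncard : ℝ) / n) x := by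
  have hn' : (n : ℝ) ≠ 0 := Nat.cast_ne_zero.2 (by omega)
  have h1 := sum_ite_mem C
  by_cases hx : x
  · simp only [hx, true_iff, bernoulliMass_true]
    rw [← h1, Finset.sum_div]
    exact Finset.sum_congr rfl fun y _ => by split_ifs <;> simp
  · simp only [hx, false_iff, bernoulliMass_false]
    have h2 : ∀ y, (if y ∉ C then (1 / n : ℝ) else 0) =
        1 / n - (if y ∈ C then (1 : ℝ) else 0) / n :=
      fun y => by split_ifs <;> simp_all
    rw [Finset.sum_congr rfl fun y _ => h2 y, Finset.sum_sub_distrib,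
      ← Finset.sum_div _ (fun y => if y ∈ C then (1 : ℝ) else 0), h1]
    simp [hn']

theorem coupledMass_nonneg (C : Set (Fin n)) (x : Fin n × Fin n) : 0 ≤ coupledMass C x := by
  have := bernoulliMass_nonneg (ncard_div_nonneg C) (ncard_div_le_one C) (x.1 ∈ C)
  rw [coupledMass]
  split_ifs <;> positivity

/-- Summing over the second coordinate cancels the denominator and leaves `1 / n`. -/
theorem sum_coupledMass_le (hn : 1 ≤ n) (C : Set (Fin n)) : ∑ x, coupledMass C x ≤ 1 := by
  rw [Fintype.sum_prod_type]
  have h1 : ∀ x, ∑ y, coupledMass C (x, y) ≤ 1 / n := by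
    intro x
    have h2 : ∀ y, coupledMass C (x, y) = (1 / n / bernoulliMass ((C.ncard : ℝ) / n) (x ∈ C)) *
        (if x ∈ C ↔ y ∈ C then (1 / n : ℝ) else 0) := by
      intro y
      rw [coupledMass]
      split_ifs
      · ring
      · ring
    rw [Finset.sum_congr rfl fun y _ => h2 y, ← Finset.mul_sum, sum_iff_mem hn, div_mul_eq_mul_div,
      mul_div_assoc]
    exact mul_le_of_le_one_right (by positivity) (div_self_le_one _)
  refine (Finset.sum_le_sum fun x _ => h1 x).trans ?_
  have hn' : (n : ℝ) ≠ 0 := Nat.cast_ne_zero.2 (by omega)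
  simp [hn']

/-- The event that no vertex of `C` has more than `2ℓ` children. -/
def Balanced {N n : ℕ} (ℓ : ℕ) (C : Set (Fin n)) (π : Fin N → Fin n) : Prop :=
  ∀ s ∈ C, childCount π s ≤ 2 * ℓ

theorem childCount_eq_card {N n : ℕ} (π : Fin N → Fin n) (s : Fin n) :
    childCount π s = (Finset.univ.filter (π · = s)).card := by
  rw [childCount, Set.ncard_eq_toFinset_card']
  congr 1
  ext
  simp

theorem Balanced.of_cons {N n ℓ : ℕ} {C : Set (Fin n)} {s : Fin n} {π : Fin N → Fin n}
    (h : Balanced ℓ C (Fin.cons s π : Fin (N + 1) → Fin n)) : Balanced ℓ C π := by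
  intro t ht
  refine le_trans ?_ (h t ht)
  rw [childCount, childCount, ← Set.ncard_image_of_injective _ (Fin.succ_injective N)]
  refine Set.ncard_le_ncard ?_
  rintro _ ⟨v, hv, rfl⟩
  simpa using hv

theorem Balanced.card_le {N n ℓ : ℕ} {C : Set (Fin n)} {π : Fin N → Fin n}
    (h : Balanced ℓ C π) : (Finset.univ.filter (π · ∈ C)).card ≤ C.ncard * (2 * ℓ) := by
  rw [Set.ncard_eq_toFinset_card', ← smul_eq_mul]
  rw [Finset.card_eq_sum_card_fiberwise (f := π) (t := C.toFinset) (by intro v; simp)]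
  refine Finset.sum_le_card_nsmul _ _ _ fun s hs => ?_
  refine le_trans ?_ (h s (by simpa using hs))
  rw [childCount_eq_card, Finset.filter_filter]
  exact Finset.card_le_card fun v => by simp

/-- The factor `1 + q` of a collision inside `C`. -/
noncomputable def collisionFactor (q : ℝ) (C : Set (Fin n)) (x y : Fin n × Fin n) : ℝ :=
  if x = y ∧ x.1 ∈ C ∧ x.2 ∈ C then 1 + q else 1

/-- A pair `x` in `C × C` has mass `1 / (n |C|)`. At most `2ℓ` positions of `f` carry the value `x`,
since already the first coordinate is balanced, so `(1 + q)^count ≤ 1 + 2q · count`. The counts add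
up to at most `2ℓ |C|`. -/
theorem sum_coupledMass_mul_prod_le {N ℓ : ℕ} (hℓ : 1 ≤ ℓ) (hn : 1 ≤ n) (hC : 1 ≤ C.ncard)
    {q : ℝ} (hq₀ : 0 ≤ q) (hq : 16 * q * (ℓ : ℝ) ^ 2 ≤ 1) (f : Fin N → Fin n × Fin n)
    (hf : Balanced ℓ C fun v => (f v).1) :
    ∑ x, coupledMass C x * ∏ v, collisionFactor q C x (f v) ≤ 1 + 4 * q * ℓ / n := by
  have hn' : (n : ℝ) ≠ 0 := Nat.cast_ne_zero.2 (by omega)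
  have hC' : (C.ncard : ℝ) ≠ 0 := Nat.cast_ne_zero.2 (by omega)
  have hqℓ : 4 * (ℓ : ℝ) * q ≤ 1 := by
    have : (1 : ℝ) ≤ ℓ := by exact_mod_cast hℓ
    nlinarith [mul_le_mul_of_nonneg_left this (mul_nonneg hq₀ (by linarith : (0 : ℝ) ≤ ℓ))]
  have h1 : ∀ x : Fin n × Fin n, coupledMass C x * ∏ v, collisionFactor q C x (f v) ≤
      coupledMass C x + 2 * q / (n * C.ncard) *
        (if x.1 ∈ C ∧ x.2 ∈ C then ((Finset.univ.filter (f · = x)).card : ℝ) else 0) := by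
    intro x
    by_cases hx : x.1 ∈ C ∧ x.2 ∈ C
    · have h2 : ∏ v, collisionFactor q C x (f v) =
          (1 + q) ^ (Finset.univ.filter (f · = x)).card := by
        simp only [collisionFactor, hx, and_true, Finset.prod_ite, Finset.prod_const, one_pow,
          mul_one, and_self, eq_comm]
      have h3 : (Finset.univ.filter (f · = x)).card ≤ 2 * ℓ := by
        refine le_trans ?_ (hf x.1 hx.1)
        rw [childCount_eq_card]
        exact Finset.card_le_card fun v => by simp +contextual
      have h4 : ((Finset.univ.filter (f · = x)).card : ℝ) ≤ 2 * ℓ := by exact_mod_cast h3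
      have h5 : coupledMass C x = 1 / (n * C.ncard) := by
        rw [coupledMass, if_pos (by simp [hx]), eq_true hx.1, bernoulliMass_true]
        field_simp
      rw [if_pos hx, h2, h5]
      -- The count is at most `2ℓ`, and `4ℓq ≤ 1`.
      have h6 := one_add_pow_le hq₀ (m := (Finset.univ.filter (f · = x)).card)
        (by nlinarith [mul_le_mul_of_nonneg_right h4 hq₀])
      calc _ ≤ 1 / (n * C.ncard : ℝ) * (1 + 2 * q * (Finset.univ.filter (f · = x)).card) :=
            mul_le_mul_of_nonneg_left h6 (by positivity)
        _ = _ := by ring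
    · rw [if_neg hx, Finset.prod_eq_one, mul_one, mul_zero, add_zero]
      intro v _
      rw [collisionFactor, if_neg fun h => hx h.2]
  have h2 : ∑ x : Fin n × Fin n,
      (if x.1 ∈ C ∧ x.2 ∈ C then ((Finset.univ.filter (f · = x)).card : ℝ) else 0) ≤
        C.ncard * (2 * ℓ) := by
    rw [← Finset.sum_filter, ← Nat.cast_sum]
    have h3 := Finset.card_eq_sum_card_fiberwise (f := f)
      (s := Finset.univ.filter fun v => (f v).1 ∈ C ∧ (f v).2 ∈ C)
      (t := Finset.univ.filter fun x : Fin n × Fin n => x.1 ∈ C ∧ x.2 ∈ C) (by intro v; simp)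
    have h4 : ∀ x ∈ Finset.univ.filter fun x : Fin n × Fin n => x.1 ∈ C ∧ x.2 ∈ C,
        ((Finset.univ.filter fun v => (f v).1 ∈ C ∧ (f v).2 ∈ C).filter (f · = x)).card =
          (Finset.univ.filter (f · = x)).card := by
      intro x hx
      rw [Finset.mem_filter_univ] at hx
      congr 1
      ext v
      simp only [Finset.mem_filter, Finset.mem_univ, true_and]
      exact ⟨fun h => h.2, fun h => ⟨by rw [h]; exact hx, h⟩⟩
    rw [Finset.sum_congr rfl h4] at h3
    rw [← h3]
    have h5 := hf.card_le
    have h6 : (Finset.univ.filter fun v => (f v).1 ∈ C ∧ (f v).2 ∈ C).card ≤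
        (Finset.univ.filter fun v => (f v).1 ∈ C).card :=
      Finset.card_le_card fun v => by simp +contextual
    exact_mod_cast h6.trans h5
  calc _ ≤ ∑ x : Fin n × Fin n, (coupledMass C x + 2 * q / (n * C.ncard) *
        (if x.1 ∈ C ∧ x.2 ∈ C then ((Finset.univ.filter (f · = x)).card : ℝ) else 0)) :=
        Finset.sum_le_sum fun x _ => h1 x
    _ ≤ 1 + 2 * q / (n * C.ncard) * (C.ncard * (2 * ℓ)) := by
        rw [Finset.sum_add_distrib, ← Finset.mul_sum]
        exact add_le_add (sum_coupledMass_le hn C) (mul_le_mul_of_nonneg_left h2 (by positivity))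
    _ = _ := by
        field_simp
        ring

theorem sum_collision_le {ℓ : ℕ} (hℓ : 1 ≤ ℓ) (hn : 1 ≤ n) (hC : 1 ≤ C.ncard)
    {q : ℝ} (hq₀ : 0 ≤ q) (hq : 16 * q * (ℓ : ℝ) ^ 2 ≤ 1) :
    ∑ f : Fin (ℓ * n) → Fin n × Fin n, (if Balanced ℓ C (fun v => (f v).1) then
      (∏ v, coupledMass C (f v)) *
        ∏ u, ∏ v, (if u < v then collisionFactor q C (f u) (f v) else 1) else 0) ≤
      Real.exp (4 * q * (ℓ : ℝ) ^ 2) := by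
  have h1 := sum_interaction_le (coupledMass C) (collisionFactor q C) (1 + 4 * q * ℓ / n)
    (coupledMass_nonneg C) (fun x y => by rw [collisionFactor]; split_ifs <;> linarith)
    (by positivity) (fun N f => Balanced ℓ C fun v => (f v).1)
    (fun N x f h => by
      refine Balanced.of_cons (s := x.1) ?_
      convert h using 1
      ext v
      refine Fin.cases ?_ (fun i => ?_) v <;> simp)
    (fun N f hf => sum_coupledMass_mul_prod_le hℓ hn hC hq₀ hq f hf) (ℓ * n)
  refine h1.trans ?_
  have hn' : (n : ℝ) ≠ 0 := Nat.cast_ne_zero.2 (by omega)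
  calc (1 + 4 * q * ℓ / n) ^ (ℓ * n) ≤ Real.exp (4 * q * ℓ / n) ^ (ℓ * n) := by
        refine pow_le_pow_left₀ (by positivity) ?_ _
        linarith [Real.add_one_le_exp (4 * q * ℓ / n)]
    _ = _ := by
        rw [← Real.exp_nat_mul]
        congr 1
        push_cast
        field_simp

end Collision

/-! ### The second moment of the likelihood ratio -/

theorem prod_edges_eq {N : ℕ} (h : Sym2 (Fin N) → ℝ) :
    ∏ e ∈ edges (Fin N), h e = ∏ u, ∏ v, if u < v then h s(u, v) else 1 := by
  have h1 : ∏ e ∈ edges (Fin N), h e = ∏ e, if e.IsDiag then 1 else h e := by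
    rw [edges, Finset.prod_filter]
    exact Finset.prod_congr rfl fun e _ => by split_ifs <;> simp_all
  rw [h1, ← Sym2.sortEquiv.symm.prod_comp, ← Finset.prod_product', Finset.univ_product_univ]
  have h2 : ∀ b : Block N, (if (Sym2.sortEquiv.symm b).IsDiag then 1 else h (Sym2.sortEquiv.symm b))
      = if b.1.1 < b.1.2 then h s(b.1.1, b.1.2) else 1 := by
    intro b
    have h3 : Sym2.sortEquiv.symm b = s(b.1.1, b.1.2) := rfl
    simp only [h3, Sym2.mk_isDiag_iff]
    have := b.2
    by_cases h4 : b.1.1 = b.1.2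
    · rw [if_pos h4, if_neg h4.not_lt]
    · rw [if_neg h4, if_pos (lt_of_le_of_ne this h4)]
  have h3 := Finset.prod_subtype (Finset.univ.filter fun b : Fin N × Fin N => b.1 ≤ b.2)
    (p := fun b => b.1 ≤ b.2) (F := inferInstance) (by simp)
    fun b => if b.1 < b.2 then h s(b.1, b.2) else 1
  rw [Finset.prod_congr rfl fun b _ => h2 b, ← h3, Finset.prod_filter]
  refine Finset.prod_congr rfl fun b _ => ?_
  by_cases h4 : b.1 < b.2
  · rw [if_pos h4.le]
  · simp [h4]

theorem sum_edgeProd_mul_div {V : Type*} [Fintype V] [DecidableEq V] (w w' d : Sym2 V → ℝ) :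
    ∑ G : SimpleGraph V, edgeProd w G * edgeProd w' G / edgeProd d G =
      ∏ e ∈ edges V, (w e * w' e / d e + (1 - w e) * (1 - w' e) / (1 - d e)) := by
  have h := sum_graph_prod fun (e : Sym2 V) x =>
    bernoulliMass (w e) x * bernoulliMass (w' e) x / bernoulliMass (d e) x
  simp only [bernoulliMass_true, bernoulliMass_false] at h
  rw [← h]
  refine Finset.sum_congr rfl fun G _ => ?_
  rw [edgeProd, edgeProd, edgeProd, ← Finset.prod_mul_distrib, ← Finset.prod_div_distrib]

/-- The edge probabilities given the parents: `2q` for edges between the children of two distinct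
vertices of `C`, and `q` for all other edges. -/
noncomputable def splitWeight {N n : ℕ} (q : ℝ) (C : Set (Fin n)) (π : Fin N → Fin n)
    (e : Sym2 (Fin N)) : ℝ :=
  if (∀ v ∈ e, π v ∈ C) ∧ ¬ (e.map π).IsDiag then 2 * q else q

section SecondMoment

variable {N n : ℕ} {q : ℝ} {C : Set (Fin n)} {π π' : Fin N → Fin n}

/-- If the pair is not inside `S`, all weights are `q`. If it is, the reference weight is `2q`;
whenever one of the two split weights is `2q` it cancels the reference, and the other law has total
mass one. Both are `q` only for a common parent under both maps, and then the factor is at most `1 +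
q` because `q` is small. -/
theorem edge_factor_le (hq₀ : 0 ≤ q) (hq : q ≤ 1 / 16) (h : ∀ v, π v ∈ C ↔ π' v ∈ C)
    (u v : Fin N) :
    splitWeight q C π s(u, v) * splitWeight q C π' s(u, v) /
        denseWeight (2 * q) q {v | π v ∈ C} s(u, v) +
      (1 - splitWeight q C π s(u, v)) * (1 - splitWeight q C π' s(u, v)) /
        (1 - denseWeight (2 * q) q {v | π v ∈ C} s(u, v)) ≤
      collisionFactor q C (π u, π' u) (π v, π' v) := by
  have hu := h u
  have hv := h v
  have e1 : (2 * q) * (2 * q) / (2 * q) + (1 - 2 * q) * (1 - 2 * q) / (1 - 2 * q) ≤ 1 := by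
    rw [mul_self_div_self, mul_self_div_self]
    linarith
  have e2 : q * q / q + (1 - q) * (1 - q) / (1 - q) ≤ 1 := by
    rw [mul_self_div_self, mul_self_div_self]
    linarith
  have h3 : (1 - 2 * q) ≠ 0 := by linarith
  have e3 : (2 * q) * q / (2 * q) + (1 - 2 * q) * (1 - q) / (1 - 2 * q) ≤ 1 := by
    rw [mul_div_cancel_left₀ _ h3]
    rcases eq_or_ne q 0 with rfl | h4
    · simp
    · rw [mul_div_cancel_left₀ _ (by simpa using h4)]
      linarith
  have e4 : q * (2 * q) / (2 * q) + (1 - q) * (1 - 2 * q) / (1 - 2 * q) ≤ 1 := by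
    rw [mul_comm q, mul_comm (1 - q)]
    exact e3
  have e5 : q * q / (2 * q) + (1 - q) * (1 - q) / (1 - 2 * q) ≤ 1 + q := by
    have h5 : q * q / (2 * q) = q / 2 := by
      rcases eq_or_ne q 0 with rfl | h4
      · simp
      · field_simp
    have h6 : (1 - q) * (1 - q) / (1 - 2 * q) ≤ 1 + q / 2 := by
      rw [div_le_iff₀ (by linarith)]
      nlinarith
    rw [h5]
    linarith
  simp only [splitWeight, denseWeight, collisionFactor, Sym2.mem_iff, forall_eq_or_imp, forall_eq,
    Sym2.map_mk, Sym2.mk_isDiag_iff, Set.mem_ofPred_eq, Prod.mk.injEq]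
  by_cases a1 : π u ∈ C
  · have a1' := hu.1 a1
    by_cases a2 : π v ∈ C
    · have a2' := hv.1 a2
      by_cases a3 : π u = π v <;> by_cases a4 : π' u = π' v <;>
        simp only [a1, a1', a2, a2', a3, a4, and_true, not_true, not_false_eq_true,
          if_true, if_false, and_false] <;> assumption
    · have a2' := mt hv.2 a2
      simp only [a2, a2', false_and, and_false, if_false]
      split_ifs
      · linarith
      · exact e2
  · have a1' := mt hu.2 a1
    simp only [a1, a1', false_and, and_false, if_false]
    exact e2

theorem splitWeight_mem (hq₀ : 0 ≤ q) (hq : q ≤ 1 / 16) (e : Sym2 (Fin N)) :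
    0 ≤ splitWeight q C π e ∧ splitWeight q C π e ≤ 1 := by
  rw [splitWeight]
  split_ifs <;> constructor <;> linarith

theorem denseWeight_mem {V : Type*} (hq₀ : 0 ≤ q) (hq : q ≤ 1 / 16) (S : Set V) (e : Sym2 V) :
    0 ≤ denseWeight (2 * q) q S e ∧ denseWeight (2 * q) q S e ≤ 1 := by
  rw [denseWeight]
  split_ifs <;> constructor <;> linarith

theorem sum_edgeProd_splitWeight_le (hq₀ : 0 ≤ q) (hq : q ≤ 1 / 16)
    (h : ∀ v, π v ∈ C ↔ π' v ∈ C) :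
    ∑ G : SimpleGraph (Fin N), edgeProd (splitWeight q C π) G * edgeProd (splitWeight q C π') G /
        edgeProd (denseWeight (2 * q) q {v | π v ∈ C}) G ≤
      ∏ u, ∏ v, if u < v then collisionFactor q C (π u, π' u) (π v, π' v) else 1 := by
  rw [sum_edgeProd_mul_div, prod_edges_eq]
  have h0 : ∀ u v : Fin N, 0 ≤ if u < v then
      splitWeight q C π s(u, v) * splitWeight q C π' s(u, v) /
        denseWeight (2 * q) q {v | π v ∈ C} s(u, v) +
      (1 - splitWeight q C π s(u, v)) * (1 - splitWeight q C π' s(u, v)) /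
        (1 - denseWeight (2 * q) q {v | π v ∈ C} s(u, v)) else 1 := by
    intro u v
    have h1 := splitWeight_mem (C := C) (π := π) hq₀ hq s(u, v)
    have h2 := splitWeight_mem (C := C) (π := π') hq₀ hq s(u, v)
    have h3 := denseWeight_mem hq₀ hq {v | π v ∈ C} s(u, v)
    split_ifs
    · exact add_nonneg (div_nonneg (mul_nonneg h1.1 h2.1) h3.1)
        (div_nonneg (mul_nonneg (by linarith [h1.2]) (by linarith [h2.2])) (by linarith [h3.2]))
    · exact zero_le_one
  refine Finset.prod_le_prod (fun u _ => Finset.prod_nonneg fun v _ => h0 u v) fun u _ =>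
    Finset.prod_le_prod (fun v _ => h0 u v) fun v _ => ?_
  split_ifs
  · exact edge_factor_le hq₀ hq h u v
  · exact le_rfl

/-- Absolute continuity: as `2q < 1`, the dense mass can vanish only if `q = 0` and `G` has an edge,
which then kills the split mass too. -/
theorem edgeProd_splitWeight_eq_zero (hq₀ : 0 ≤ q) (hq : q ≤ 1 / 16) {S : Set (Fin N)}
    {G : SimpleGraph (Fin N)} (h : edgeProd (denseWeight (2 * q) q S) G = 0) :
    edgeProd (splitWeight q C π) G = 0 := by
  obtain ⟨e, he, h0⟩ := Finset.prod_eq_zero_iff.1 h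
  refine Finset.prod_eq_zero he ?_
  rw [bernoulliMass, denseWeight] at h0
  have hG : e ∈ G.edgeSet := by
    by_contra hG
    rw [if_neg hG] at h0
    split_ifs at h0 <;> linarith
  rw [if_pos hG] at h0
  have : q = 0 := by split_ifs at h0 <;> linarith
  rw [bernoulliMass, if_pos hG, splitWeight, this]
  simp

end SecondMoment

/-- The Cauchy–Schwarz inequality for a sub-probability `a` and a probability `t`. -/
theorem sum_abs_sub_le_sqrt {ι : Type*} [Fintype ι] (a t : ι → ℝ) (ht : ∀ i, 0 ≤ t i)
    (ht₁ : ∑ i, t i = 1) (h : ∀ i, t i = 0 → a i = 0) :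
    ∑ i, |a i - t i| ≤ √(∑ i, a i ^ 2 / t i - 2 * ∑ i, a i + 1) := by
  refine Real.le_sqrt_of_sq_le ?_
  -- Write `|a - t|` as `√t · (|a - t| / √t)`; indices with `t i = 0` contribute nothing, by `h`.
  have h1 := Finset.sum_sq_le_sum_mul_sum_of_sq_le_mul Finset.univ (r := fun i => |a i - t i|)
    (f := t) (g := fun i => (a i - t i) ^ 2 / t i) (fun i _ => ht i)
    (fun i _ => div_nonneg (sq_nonneg _) (ht i)) (fun i _ => by
      rw [sq_abs]
      refine le_of_eq ?_
      by_cases h0 : t i = 0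
      · simp [h0, h i h0]
      · field_simp)
  rw [ht₁, one_mul] at h1
  refine h1.trans (le_of_eq ?_)
  have h2 : ∀ i, (a i - t i) ^ 2 / t i = a i ^ 2 / t i - 2 * a i + t i := by
    intro i
    by_cases h0 : t i = 0
    · simp [h0, h i h0]
    · field_simp
      ring
  rw [Finset.sum_congr rfl fun i _ => h2 i, Finset.sum_add_distrib, Finset.sum_sub_distrib, ht₁,
    Finset.mul_sum]

/-! ### Comparison of the split and the planted dense models -/

/-- The mass function of the set of all vertices whose parents lie in `C`. -/
noncomputable def setMass {N n : ℕ} (C : Set (Fin n)) (S : Set (Fin N)) : ℝ :=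
  ∏ v, bernoulliMass ((C.ncard : ℝ) / n) (v ∈ S)

/-- The joint mass of the set of vertices whose parents lie in `C`, and of the split graph, on the
event that the parents are balanced. -/
noncomputable def splitJoint {N n : ℕ} (ℓ : ℕ) (q : ℝ) (C : Set (Fin n))
    (j : Set (Fin N) × SimpleGraph (Fin N)) : ℝ :=
  ∑ π : Fin N → Fin n, if Balanced ℓ C π ∧ {v | π v ∈ C} = j.1 then
    (1 / n : ℝ) ^ N * edgeProd (splitWeight q C π) j.2 else 0

/-- The joint mass of the planted set and the planted dense graph. -/
noncomputable def denseJoint {N n : ℕ} (q : ℝ) (C : Set (Fin n))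
    (j : Set (Fin N) × SimpleGraph (Fin N)) : ℝ :=
  setMass C j.1 * edgeProd (denseWeight (2 * q) q j.1) j.2

/-- The probability that the parents are not balanced. -/
noncomputable def unbalancedProb (N n ℓ : ℕ) (C : Set (Fin n)) : ℝ :=
  ∑ π : Fin N → Fin n, if Balanced ℓ C π then 0 else (1 / n : ℝ) ^ N

section Joint

variable {N n ℓ : ℕ} {q : ℝ} {C : Set (Fin n)}

theorem setMass_nonneg (C : Set (Fin n)) (S : Set (Fin N)) : 0 ≤ setMass C S :=
  Finset.prod_nonneg fun _ _ =>
    bernoulliMass_nonneg (ncard_div_nonneg C) (ncard_div_le_one C) _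

theorem sum_parents_eq_setMass (hn : 1 ≤ n) (C : Set (Fin n)) (S : Set (Fin N)) :
    (∑ π : Fin N → Fin n, if {v | π v ∈ C} = S then (1 / n : ℝ) ^ N else 0) = setMass C S := by
  have h1 : ∀ π : Fin N → Fin n, (if {v | π v ∈ C} = S then (1 / n : ℝ) ^ N else 0) =
      ∏ v, if v ∈ S ↔ π v ∈ C then (1 / n : ℝ) else 0 := by
    intro π
    by_cases h : {v | π v ∈ C} = S
    · subst h
      simp
    · rw [if_neg h]
      have : ∃ v, ¬ (v ∈ S ↔ π v ∈ C) := by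
        by_contra h2
        push Not at h2
        exact h (Set.ext fun v => (h2 v).symm)
      obtain ⟨v, hv⟩ := this
      exact (Finset.prod_eq_zero (Finset.mem_univ v) (if_neg hv)).symm
  rw [Finset.sum_congr rfl fun π _ => h1 π, setMass,
    sum_pi_prod fun (v : Fin N) y => if v ∈ S ↔ y ∈ C then (1 / n : ℝ) else 0]
  exact Finset.prod_congr rfl fun v _ => sum_iff_mem hn C (v ∈ S)

theorem sum_parents_const (hn : 1 ≤ n) : ∑ _π : Fin N → Fin n, (1 / n : ℝ) ^ N = 1 := by
  have hn' : (n : ℝ) ≠ 0 := Nat.cast_ne_zero.2 (by omega)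
  rw [Finset.sum_const, nsmul_eq_mul, Finset.card_univ, Fintype.card_fun, Fintype.card_fin,
    Fintype.card_fin, Nat.cast_pow, ← mul_pow, mul_one_div_cancel hn', one_pow]

theorem sum_setMass (hn : 1 ≤ n) (C : Set (Fin n)) : ∑ S : Set (Fin N), setMass C S = 1 := by
  simp_rw [← sum_parents_eq_setMass hn C]
  rw [Finset.sum_comm]
  simp only [Finset.sum_ite_eq, Finset.mem_univ, if_true]
  exact sum_parents_const hn

theorem sum_denseJoint (hn : 1 ≤ n) (q : ℝ) (C : Set (Fin n)) :
    ∑ j : Set (Fin N) × SimpleGraph (Fin N), denseJoint q C j = 1 := by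
  rw [Fintype.sum_prod_type]
  simp only [denseJoint]
  simp_rw [← Finset.mul_sum, sum_edgeProd, mul_one]
  exact sum_setMass hn C

theorem denseJoint_nonneg (hq₀ : 0 ≤ q) (hq : q ≤ 1 / 16) (C : Set (Fin n))
    (j : Set (Fin N) × SimpleGraph (Fin N)) : 0 ≤ denseJoint q C j :=
  mul_nonneg (setMass_nonneg C _) (edgeProd_nonneg (fun e => denseWeight_mem hq₀ hq _ e) _)

theorem splitJoint_eq_zero (hn : 1 ≤ n) (hq₀ : 0 ≤ q) (hq : q ≤ 1 / 16)
    {j : Set (Fin N) × SimpleGraph (Fin N)} (h : denseJoint q C j = 0) :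
    splitJoint ℓ q C j = 0 := by
  refine Finset.sum_eq_zero fun π _ => ?_
  split_ifs with h1
  · rcases mul_eq_zero.1 h with h2 | h2
    · rw [← sum_parents_eq_setMass hn, Finset.sum_eq_zero_iff_of_nonneg
        (fun π _ => by split_ifs <;> positivity)] at h2
      have h3 := h2 π (Finset.mem_univ π)
      rw [if_pos h1.2] at h3
      rw [h3, zero_mul]
    · rw [edgeProd_splitWeight_eq_zero hq₀ hq h2, mul_zero]
  · rfl

theorem sum_splitJoint (hn : 1 ≤ n) :
    ∑ j : Set (Fin N) × SimpleGraph (Fin N), splitJoint ℓ q C j =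
      1 - unbalancedProb N n ℓ C := by
  simp only [splitJoint]
  rw [Finset.sum_comm, eq_sub_iff_add_eq, unbalancedProb, ← Finset.sum_add_distrib]
  refine Eq.trans (Finset.sum_congr rfl fun π _ => ?_) (sum_parents_const (N := N) hn)
  rw [Fintype.sum_prod_type]
  by_cases h : Balanced ℓ C π
  · simp only [h, true_and, if_true, add_zero]
    rw [Finset.sum_comm]
    simp only [Finset.sum_ite_eq, Finset.mem_univ, if_true]
    rw [← Finset.mul_sum, sum_edgeProd, mul_one]
  · simp [h]

theorem prod_coupledMass {π π' : Fin N → Fin n} (h : ∀ v, π v ∈ C ↔ π' v ∈ C) :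
    ∏ v, coupledMass C (π v, π' v) =
      (1 / n : ℝ) ^ N * (1 / n : ℝ) ^ N / setMass C {v | π v ∈ C} := by
  have h1 : ∀ v, coupledMass C (π v, π' v) =
      (1 / n : ℝ) ^ 2 / bernoulliMass ((C.ncard : ℝ) / n) (v ∈ {v | π v ∈ C}) :=
    fun v => by rw [coupledMass, if_pos (h v)]; rfl
  rw [Finset.prod_congr rfl fun v _ => h1 v, Finset.prod_div_distrib, setMass]
  simp only [Finset.prod_const, Finset.card_univ, Fintype.card_fin]
  ring

/-- The square expands over pairs of parent maps, and only pairs with the same `S` matter. Division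
by the probability of `S` produces `coupledMass`; for fixed maps the sum over graphs is bounded by
the collision factors. Only the balance of the first map is kept. -/
theorem sum_splitJoint_sq_div_le (hℓ : 1 ≤ ℓ) (hn : 1 ≤ n) (hC : 1 ≤ C.ncard)
    (hq₀ : 0 ≤ q) (hq : 16 * q * (ℓ : ℝ) ^ 2 ≤ 1) :
    ∑ j : Set (Fin (ℓ * n)) × SimpleGraph (Fin (ℓ * n)),
      splitJoint ℓ q C j ^ 2 / denseJoint q C j ≤ Real.exp (4 * q * (ℓ : ℝ) ^ 2) := by
  have hq' := le_one_div_sixteen hℓ hq₀ hq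
  simp_rw [splitJoint, sq, Finset.sum_mul_sum, Finset.sum_div]
  rw [Finset.sum_comm]
  rw [Finset.sum_congr rfl fun π _ => Finset.sum_comm]
  refine le_trans ?_ (sq (ℓ : ℝ) ▸ sum_collision_le hℓ hn hC hq₀ hq)
  rw [← (Equiv.arrowProdEquivProdArrow (Fin (ℓ * n)) (fun _ => Fin n) fun _ => Fin n).symm.sum_comp,
    Fintype.sum_prod_type]
  refine Finset.sum_le_sum fun π _ => Finset.sum_le_sum fun π' _ => ?_
  change _ ≤ if Balanced ℓ C π then (∏ v, coupledMass C (π v, π' v)) * ∏ u, ∏ v,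
      (if u < v then collisionFactor q C (π u, π' u) (π v, π' v) else 1) else 0
  have h0 : 0 ≤ (∏ v, coupledMass C (π v, π' v)) * ∏ u, ∏ v,
      (if u < v then collisionFactor q C (π u, π' u) (π v, π' v) else 1) := by
    refine mul_nonneg (Finset.prod_nonneg fun v _ => coupledMass_nonneg C _)
      (Finset.prod_nonneg fun u _ => Finset.prod_nonneg fun v _ => ?_)
    rw [collisionFactor]
    split_ifs <;> linarith
  by_cases hb : Balanced ℓ C π
  swap
  · simp [hb]
  rw [if_pos hb]
  by_cases hb' : Balanced ℓ C π' ∧ {v | π' v ∈ C} = {v | π v ∈ C}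
  · have h : ∀ v, π v ∈ C ↔ π' v ∈ C := fun v => (Set.ext_iff.1 hb'.2 v).symm
    rw [Fintype.sum_prod_type, Finset.sum_eq_single {v | π v ∈ C}]
    · simp only [hb, hb'.1, hb'.2, and_self, if_true]
      rw [prod_coupledMass h]
      refine le_trans (le_of_eq ?_) (mul_le_mul_of_nonneg_left
        (sum_edgeProd_splitWeight_le hq₀ hq' h) ?_)
      · rw [Finset.mul_sum]
        refine Finset.sum_congr rfl fun G _ => ?_
        rw [denseJoint]
        ring
      · exact div_nonneg (by positivity) (setMass_nonneg C _)
    · intro S _ hS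
      refine Finset.sum_eq_zero fun G _ => ?_
      rw [if_neg fun h => hS h.2.symm]
      simp
    · simp
  · refine le_trans (le_of_eq ?_) h0
    refine Finset.sum_eq_zero fun j _ => ?_
    by_cases h1 : {v | π v ∈ C} = j.1
    · rw [if_neg (c := Balanced ℓ C π' ∧ {v | π' v ∈ C} = j.1) (by rwa [← h1])]
      simp
    · rw [if_neg fun h => h1 h.2]
      simp

/-- The truncated law has total mass `1 - u`, with `u` the probability of imbalance, so
Cauchy–Schwarz leaves `exp(4qℓ²) - 2(1 - u) + 1` under the root. -/
theorem sum_abs_splitJoint_sub_le (hℓ : 1 ≤ ℓ) (hn : 1 ≤ n) (hC : 1 ≤ C.ncard)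
    (hq₀ : 0 ≤ q) (hq : 16 * q * (ℓ : ℝ) ^ 2 ≤ 1) :
    ∑ j : Set (Fin (ℓ * n)) × SimpleGraph (Fin (ℓ * n)),
      |splitJoint ℓ q C j - denseJoint q C j| ≤
        √(Real.exp (4 * q * (ℓ : ℝ) ^ 2) - 1 + 2 * unbalancedProb (ℓ * n) n ℓ C) := by
  have hq' := le_one_div_sixteen hℓ hq₀ hq
  refine (sum_abs_sub_le_sqrt _ _ (denseJoint_nonneg hq₀ hq' C) (sum_denseJoint hn q C)
    fun j hj => splitJoint_eq_zero hn hq₀ hq' hj).trans (Real.sqrt_le_sqrt ?_)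
  rw [sum_splitJoint hn]
  linarith [sum_splitJoint_sq_div_le hℓ hn hC hq₀ hq]

/-- A Chernoff bound for the number of children of a vertex. -/
theorem sum_childCount_gt_le (hn : 1 ≤ n) (ℓ : ℕ) (s : Fin n) :
    (∑ π : Fin (ℓ * n) → Fin n, if childCount π s ≤ 2 * ℓ then 0 else (1 / n : ℝ) ^ (ℓ * n)) ≤
      Real.exp (-(ℓ : ℝ) / 18) := by
  have hn' : (n : ℝ) ≠ 0 := Nat.cast_ne_zero.2 (by omega)
  -- Markov's inequality for `2 ^ childCount` at level `2 ^ (2ℓ) = 4 ^ ℓ`. The expectation is `(1 +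
  -- 1/n)^(ℓn) ≤ exp ℓ`, and `exp(19/18) ≤ 4` gives the rate `1/18`.
  have h1 : ∀ π : Fin (ℓ * n) → Fin n,
      (if childCount π s ≤ 2 * ℓ then 0 else (1 / n : ℝ) ^ (ℓ * n)) ≤
        (∏ v, (1 / n : ℝ) * if π v = s then 2 else 1) / 4 ^ ℓ := by
    intro π
    rw [Finset.prod_mul_distrib, Finset.prod_ite, Finset.prod_const, Finset.prod_const,
      Finset.prod_const, one_pow, mul_one, ← childCount_eq_card, Finset.card_univ,
      Fintype.card_fin]
    split_ifs with h
    · positivity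
    · rw [le_div_iff₀ (by positivity)]
      refine mul_le_mul_of_nonneg_left ?_ (by positivity)
      calc (4 : ℝ) ^ ℓ = 2 ^ (2 * ℓ) := by rw [pow_mul]; norm_num
        _ ≤ 2 ^ childCount π s := pow_le_pow_right₀ one_le_two (by omega)
  refine (Finset.sum_le_sum fun π _ => h1 π).trans ?_
  rw [← Finset.sum_div, sum_pi_prod fun (_ : Fin (ℓ * n)) y => (1 / n : ℝ) * if y = s then 2 else 1]
  have h2 : ∑ y : Fin n, (1 / n : ℝ) * (if y = s then 2 else 1) = 1 + 1 / n := by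
    have : ∀ y : Fin n, (1 / n : ℝ) * (if y = s then 2 else 1) =
        1 / n + if y = s then (1 / n : ℝ) else 0 := fun y => by split_ifs <;> ring
    rw [Finset.sum_congr rfl fun y _ => this y, Finset.sum_add_distrib]
    simp [hn']
  simp only [h2, Finset.prod_const, Finset.card_univ, Fintype.card_fin]
  have h3 : (1 + 1 / n : ℝ) ^ (ℓ * n) ≤ Real.exp ℓ := by
    calc (1 + 1 / n : ℝ) ^ (ℓ * n) ≤ Real.exp (1 / n) ^ (ℓ * n) := by
          refine pow_le_pow_left₀ (by positivity) ?_ _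
          linarith [Real.add_one_le_exp (1 / n : ℝ)]
      _ = _ := by
          rw [← Real.exp_nat_mul]
          congr 1
          push_cast
          field_simp
  rw [div_le_iff₀ (by positivity)]
  refine h3.trans ?_
  have h4 : Real.exp (19 / 18) ≤ 4 := by
    have h5 := Real.exp_one_lt_d9
    have h6 : Real.exp (1 / 18) ≤ 1 + 2 * (1 / 18) := by
      have := (abs_le.1 (Real.abs_exp_sub_one_le (x := 1 / 18)
        (by rw [abs_of_nonneg (by norm_num)]; norm_num))).2
      rw [abs_of_nonneg (by norm_num)] at this
      linarith
    rw [show (19 / 18 : ℝ) = 1 + 1 / 18 by norm_num, Real.exp_add]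
    nlinarith [Real.exp_pos (1 / 18), Real.exp_pos 1]
  calc Real.exp ℓ = Real.exp (-(ℓ : ℝ) / 18) * Real.exp (19 / 18) ^ ℓ := by
        rw [← Real.exp_nat_mul, ← Real.exp_add]
        congr 1
        ring
    _ ≤ _ := mul_le_mul_of_nonneg_left (pow_le_pow_left₀ (Real.exp_pos _).le h4 ℓ)
        (Real.exp_pos _).le

theorem unbalancedProb_nonneg (N n ℓ : ℕ) (C : Set (Fin n)) : 0 ≤ unbalancedProb N n ℓ C :=
  Finset.sum_nonneg fun π _ => by split_ifs <;> positivity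

/-- Union bound over the vertices of `C`. -/
theorem unbalancedProb_le (hn : 1 ≤ n) (ℓ : ℕ) (C : Set (Fin n)) :
    unbalancedProb (ℓ * n) n ℓ C ≤ C.ncard * Real.exp (-(ℓ : ℝ) / 18) := by
  have h1 : ∀ π : Fin (ℓ * n) → Fin n,
      (if Balanced ℓ C π then 0 else (1 / n : ℝ) ^ (ℓ * n)) ≤
        ∑ s ∈ C.toFinset, if childCount π s ≤ 2 * ℓ then 0 else (1 / n : ℝ) ^ (ℓ * n) := by
    intro π
    have hnn : ∀ s ∈ C.toFinset,
        0 ≤ if childCount π s ≤ 2 * ℓ then 0 else (1 / n : ℝ) ^ (ℓ * n) :=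
      fun s _ => by split_ifs <;> positivity
    split_ifs with h
    · exact Finset.sum_nonneg hnn
    · simp only [Balanced, not_forall] at h
      obtain ⟨s, hs, h⟩ := h
      refine le_trans ?_ (Finset.single_le_sum hnn (Set.mem_toFinset.2 hs))
      rw [if_neg h]
  refine (Finset.sum_le_sum fun π _ => h1 π).trans ?_
  rw [Finset.sum_comm, Set.ncard_eq_toFinset_card', ← nsmul_eq_mul]
  exact Finset.sum_le_card_nsmul _ _ _ fun s _ => sum_childCount_gt_le hn ℓ s

end Joint

/-! ### The total variation bound -/

/-- The edge probabilities of the blocks, after `P'` is replaced by a binomial law. -/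
noncomputable def blockProb {N n : ℕ} (ℓ : ℕ) (q : ℝ) (C : Set (Fin n)) (π : Fin N → Fin n)
    (b : Block n) : ℝ :=
  if b.1.1 ≠ b.1.2 ∧ (b.1.1 ∈ C ∧ b.1.2 ∈ C) ∧
      childCount π b.1.1 ≤ 2 * ℓ ∧ childCount π b.1.2 ≤ 2 * ℓ then 2 * q else q

theorem sqrt_add_le {a b : ℝ} (ha : 0 ≤ a) (hb : 0 ≤ b) : √(a + b) ≤ √a + √b := by
  refine Real.sqrt_le_iff.2 ⟨by positivity, ?_⟩
  rw [add_sq, Real.sq_sqrt ha, Real.sq_sqrt hb]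
  have : 0 ≤ 2 * √a * √b := by positivity
  linarith

section Bound

variable {N n ℓ : ℕ} {γ q : ℝ} {C : Set (Fin n)} {π : Fin N → Fin n}

theorem blockProb_mem (hq₀ : 0 ≤ q) (hq : q ≤ 1 / 16) (b : Block n) :
    0 ≤ blockProb ℓ q C π b ∧ blockProb ℓ q C π b ≤ 1 := by
  rw [blockProb]
  split_ifs <;> constructor <;> linarith

/-- For balanced parents the size restriction holds automatically inside `C`. -/
theorem blockProb_blockOf (hπ : Balanced ℓ C π) (e : Sym2 (Fin N)) :
    blockProb ℓ q C π (blockOf π e) = splitWeight q C π e := by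
  have h1 : (∀ v ∈ e, π v ∈ C) ↔ (blockOf π e).1.1 ∈ C ∧ (blockOf π e).1.2 ∈ C := by
    have h2 : (∀ v ∈ e, π v ∈ C) ↔ ∀ w ∈ e.map π, w ∈ C := by
      simp only [Sym2.mem_map]
      aesop
    rw [h2, ← mk_sortEquiv (e.map π)]
    simp [blockOf]
  have h3 : (e.map π).IsDiag ↔ (blockOf π e).1.1 = (blockOf π e).1.2 := by
    rw [← mk_sortEquiv (e.map π), Sym2.mk_isDiag_iff]
    rfl
  simp only [blockProb, splitWeight, h1, h3]
  refine if_congr ?_ rfl rfl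
  exact ⟨fun h => ⟨h.2.1, h.1⟩, fun h => ⟨h.2, h.1, hπ _ h.1.1, hπ _ h.1.2⟩⟩

theorem graphMass_blockProb (hq₀ : 0 ≤ q) (hq : q ≤ 1 / 16) (hπ : Balanced ℓ C π)
    (G : SimpleGraph (Fin N)) :
    graphMass π (fun b => binomialMass (blockEdges π b).ncard (blockProb ℓ q C π b)) G =
      edgeProd (splitWeight q C π) G := by
  rw [graphMass_binomialMass (blockProb_mem hq₀ hq)]
  simp only [blockProb_blockOf hπ]

theorem ncard_blockEdges_of_ne {b : Block n} (h : b.1.1 ≠ b.1.2) :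
    (blockEdges π b).ncard = childCount π b.1.1 * childCount π b.1.2 := by
  rw [ncard_pairsBetween, blockSize, if_neg h]

theorem isMassFunction_meanMass (hℓ : 1 ≤ ℓ) (hγ₀ : 0 < γ) (hγ : γ ≤ 1 / 2) (hq₀ : 0 ≤ q)
    (hq : 16 * q * (ℓ : ℝ) ^ 2 ≤ 1) (b : Block n) :
    IsMassFunction (blockEdges π b).ncard (meanMass ℓ γ q C π b) := by
  have hq' := le_one_div_sixteen hℓ hq₀ hq
  rw [meanMass]
  split_ifs with h
  · rw [ncard_blockEdges_of_ne h.1]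
    exact isMassFunction_massP hγ₀ hγ hq₀ hq' (blockSize_mul_le hq₀ hq h.2.2.1 h.2.2.2)
  · exact isMassFunction_binomialMass hq₀ (by linarith) _

/-- A block that uses `P'` has at most `(2ℓ)²` possible edges, so `2Lq ≤ 8qℓ²`. -/
theorem sum_abs_meanMass_sub_le (hℓ : 1 ≤ ℓ) (hγ₀ : 0 < γ) (hq₀ : 0 ≤ q)
    (hq : 16 * q * (ℓ : ℝ) ^ 2 ≤ 1) (b : Block n) :
    ∑ m ∈ Finset.range ((blockEdges π b).ncard + 1), |meanMass ℓ γ q C π b m -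
        binomialMass (blockEdges π b).ncard (blockProb ℓ q C π b) m| ≤
      if b.1.1 ∈ C ∧ b.1.2 ∈ C then 4 * (8 * q * (ℓ : ℝ) ^ 2) ^ (cutoff γ + 1) else 0 := by
  have hq' := le_one_div_sixteen hℓ hq₀ hq
  rw [meanMass, blockProb]
  by_cases h : b.1.1 ≠ b.1.2 ∧ (b.1.1 ∈ C ∧ b.1.2 ∈ C) ∧
      childCount π b.1.1 ≤ 2 * ℓ ∧ childCount π b.1.2 ≤ 2 * ℓ
  · rw [if_pos h, if_pos h, if_pos h.2.1]
    refine (sum_abs_massP_sub_le hγ₀ hq₀ (by linarith)).trans ?_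
    have h1 : ((blockEdges π b).ncard : ℝ) ≤ (2 * ℓ) * (2 * ℓ) := by
      rw [ncard_blockEdges_of_ne h.1]
      exact_mod_cast Nat.mul_le_mul h.2.2.1 h.2.2.2
    have h2 : 2 * ((blockEdges π b).ncard : ℝ) * q ≤ 8 * q * (ℓ : ℝ) ^ 2 := by
      nlinarith [mul_le_mul_of_nonneg_right h1 hq₀]
    gcongr
  · rw [if_neg h, if_neg h]
    simp only [sub_self, abs_zero, Finset.sum_const_zero]
    split_ifs <;> positivity

theorem sum_abs_graphMass_meanMass_sub_le (hℓ : 1 ≤ ℓ) (hγ₀ : 0 < γ) (hγ : γ ≤ 1 / 2)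
    (hq₀ : 0 ≤ q) (hq : 16 * q * (ℓ : ℝ) ^ 2 ≤ 1) (π : Fin N → Fin n) :
    ∑ G : SimpleGraph (Fin N), |graphMass π (meanMass ℓ γ q C π) G -
        graphMass π (fun b => binomialMass (blockEdges π b).ncard (blockProb ℓ q C π b)) G| ≤
      4 * (C.ncard : ℝ) ^ 2 * (8 * q * (ℓ : ℝ) ^ 2) ^ (cutoff γ + 1) := by
  have hq' := le_one_div_sixteen hℓ hq₀ hq
  refine (sum_abs_graphMass_sub_le (isMassFunction_meanMass hℓ hγ₀ hγ hq₀ hq) fun b =>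
    isMassFunction_binomialMass (blockProb_mem hq₀ hq' b).1 (blockProb_mem hq₀ hq' b).2 _).trans ?_
  refine (Finset.sum_le_sum fun b _ => sum_abs_meanMass_sub_le hℓ hγ₀ hq₀ hq b).trans ?_
  rw [← Finset.sum_filter, Finset.sum_const, nsmul_eq_mul]
  have h1 : (Finset.univ.filter fun b : Block n => b.1.1 ∈ C ∧ b.1.2 ∈ C).card ≤ C.ncard ^ 2 := by
    rw [sq, Set.ncard_eq_toFinset_card', ← Finset.card_product]
    refine Finset.card_le_card_of_injOn Subtype.val (fun b hb => ?_) Subtype.val_injective.injOn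
    simpa using hb
  have h2 : ((Finset.univ.filter fun b : Block n => b.1.1 ∈ C ∧ b.1.2 ∈ C).card : ℝ) ≤
      (C.ncard : ℝ) ^ 2 := by exact_mod_cast h1
  calc _ ≤ (C.ncard : ℝ) ^ 2 * (4 * (8 * q * (ℓ : ℝ) ^ 2) ^ (cutoff γ + 1)) :=
        mul_le_mul_of_nonneg_right h2 (by positivity)
    _ = _ := by ring

/-- The mass function of the output, after `P'` is replaced by a binomial law. -/
noncomputable def splitMass (ℓ n : ℕ) (q : ℝ) (C : Set (Fin n))
    (G : SimpleGraph (Fin (ℓ * n))) : ℝ :=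
  ∑ π : Fin (ℓ * n) → Fin n, (1 / n : ℝ) ^ (ℓ * n) *
    graphMass π (fun b => binomialMass (blockEdges π b).ncard (blockProb ℓ q C π b)) G

theorem sum_abs_cliqueMass_sub_splitMass_le (hℓ : 1 ≤ ℓ) (hn : 1 ≤ n) (hγ₀ : 0 < γ)
    (hγ : γ ≤ 1 / 2) (hq₀ : 0 ≤ q) (hq : 16 * q * (ℓ : ℝ) ^ 2 ≤ 1) (C : Set (Fin n)) :
    ∑ G, |cliqueMass ℓ n γ q C G - splitMass ℓ n q C G| ≤
      4 * (C.ncard : ℝ) ^ 2 * (8 * q * (ℓ : ℝ) ^ 2) ^ (cutoff γ + 1) := by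
  have h1 : ∀ G, |cliqueMass ℓ n γ q C G - splitMass ℓ n q C G| ≤
      ∑ π : Fin (ℓ * n) → Fin n, (1 / n : ℝ) ^ (ℓ * n) *
        |graphMass π (meanMass ℓ γ q C π) G -
          graphMass π (fun b => binomialMass (blockEdges π b).ncard (blockProb ℓ q C π b)) G| := by
    intro G
    rw [cliqueMass, splitMass, ← Finset.sum_sub_distrib]
    refine (Finset.abs_sum_le_sum_abs _ _).trans (Finset.sum_le_sum fun π _ => ?_)
    rw [← mul_sub, abs_mul, abs_of_nonneg (by positivity : (0 : ℝ) ≤ (1 / n : ℝ) ^ (ℓ * n))]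
  refine (Finset.sum_le_sum fun G _ => h1 G).trans ?_
  rw [Finset.sum_comm, Finset.sum_congr rfl fun π _ => (Finset.mul_sum _ _ _).symm]
  refine (Finset.sum_le_sum fun π _ => mul_le_mul_of_nonneg_left
    (sum_abs_graphMass_meanMass_sub_le (C := C) hℓ hγ₀ hγ hq₀ hq π) (by positivity)).trans ?_
  rw [← Finset.sum_mul, sum_parents_const hn, one_mul]

theorem sum_graphMass {r : Block n → ℝ} (hr : ∀ b, 0 ≤ r b ∧ r b ≤ 1) (π : Fin N → Fin n) :
    ∑ G, graphMass π (fun b => binomialMass (blockEdges π b).ncard (r b)) G = 1 := by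
  simp_rw [graphMass_binomialMass hr]
  exact sum_edgeProd _

/-- Forgetting `S` does not increase the distance. Unbalanced parents are missing from `splitJoint`
and add at most their probability. -/
theorem sum_abs_splitMass_sub_le (hℓ : 1 ≤ ℓ) (hn : 1 ≤ n) (hC : 1 ≤ C.ncard) (hq₀ : 0 ≤ q)
    (hq : 16 * q * (ℓ : ℝ) ^ 2 ≤ 1) :
    ∑ G, |splitMass ℓ n q C G - ∑ S, denseJoint q C (S, G)| ≤
      √(Real.exp (4 * q * (ℓ : ℝ) ^ 2) - 1 + 2 * unbalancedProb (ℓ * n) n ℓ C) +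
        unbalancedProb (ℓ * n) n ℓ C := by
  have hq' := le_one_div_sixteen hℓ hq₀ hq
  have h1 : ∀ G, splitMass ℓ n q C G = ∑ S, splitJoint ℓ q C (S, G) +
      ∑ π : Fin (ℓ * n) → Fin n, (if Balanced ℓ C π then 0 else (1 / n : ℝ) ^ (ℓ * n)) *
        graphMass π (fun b => binomialMass (blockEdges π b).ncard (blockProb ℓ q C π b)) G := by
    intro G
    simp only [splitJoint]
    rw [Finset.sum_comm, ← Finset.sum_add_distrib, splitMass]
    refine Finset.sum_congr rfl fun π _ => ?_
    by_cases h : Balanced ℓ C π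
    · simp [h, graphMass_blockProb hq₀ hq' h]
    · simp [h]
  have h2 : ∀ G, 0 ≤ ∑ π : Fin (ℓ * n) → Fin n,
      (if Balanced ℓ C π then 0 else (1 / n : ℝ) ^ (ℓ * n)) *
        graphMass π (fun b => binomialMass (blockEdges π b).ncard (blockProb ℓ q C π b)) G := by
    intro G
    refine Finset.sum_nonneg fun π _ => mul_nonneg (by split_ifs <;> positivity)
      (graphMass_nonneg (fun b => ?_) G)
    exact isMassFunction_binomialMass (blockProb_mem hq₀ hq' b).1 (blockProb_mem hq₀ hq' b).2 _
  have h3 : ∑ G, ∑ π : Fin (ℓ * n) → Fin n,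
      (if Balanced ℓ C π then 0 else (1 / n : ℝ) ^ (ℓ * n)) *
        graphMass π (fun b => binomialMass (blockEdges π b).ncard (blockProb ℓ q C π b)) G =
      unbalancedProb (ℓ * n) n ℓ C := by
    rw [Finset.sum_comm]
    simp_rw [← Finset.mul_sum, sum_graphMass (blockProb_mem hq₀ hq'), mul_one]
    rfl
  have h4 : ∀ G, |splitMass ℓ n q C G - ∑ S, denseJoint q C (S, G)| ≤
      ∑ S, |splitJoint ℓ q C (S, G) - denseJoint q C (S, G)| +
      ∑ π : Fin (ℓ * n) → Fin n, (if Balanced ℓ C π then 0 else (1 / n : ℝ) ^ (ℓ * n)) *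
        graphMass π (fun b => binomialMass (blockEdges π b).ncard (blockProb ℓ q C π b)) G := by
    intro G
    rw [h1, add_sub_right_comm, ← Finset.sum_sub_distrib]
    refine (abs_add_le _ _).trans ?_
    rw [abs_of_nonneg (h2 G)]
    exact add_le_add_left (Finset.abs_sum_le_sum_abs _ _) _
  refine (Finset.sum_le_sum fun G _ => h4 G).trans ?_
  rw [Finset.sum_add_distrib, h3, ← Fintype.sum_prod_type_right
    (f := fun j => |splitJoint ℓ q C j - denseJoint q C j|)]
  exact add_le_add_left (sum_abs_splitJoint_sub_le hℓ hn hC hq₀ hq) _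

theorem sum_abs_cliqueMass_sub_le (hℓ : 1 ≤ ℓ) (hn : 1 ≤ n) (hC : 1 ≤ C.ncard) (hγ₀ : 0 < γ)
    (hγ : γ ≤ 1 / 2) (hq₀ : 0 ≤ q) (hq : 16 * q * (ℓ : ℝ) ^ 2 ≤ 1) :
    1 / 2 * ∑ G, |cliqueMass ℓ n γ q C G - ∑ S, denseJoint q C (S, G)| ≤
      Real.exp (-((C.ncard * ℓ : ℕ) : ℝ) / 12)
        + 1.5 * (C.ncard : ℝ) * Real.exp (-(ℓ : ℝ) / 18)
        + 2 * (C.ncard : ℝ) ^ 2 * (8 * q * (ℓ : ℝ) ^ 2) ^ (cutoff γ + 1)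
        + 0.5 * Real.sqrt (Real.exp (72 * Real.exp 1 ^ 2 * q * (ℓ : ℝ) ^ 2) - 1)
        + Real.sqrt (0.5 * (C.ncard : ℝ)) * Real.exp (-(ℓ : ℝ) / 36) := by
  have h1 : ∑ G, |cliqueMass ℓ n γ q C G - ∑ S, denseJoint q C (S, G)| ≤
      4 * (C.ncard : ℝ) ^ 2 * (8 * q * (ℓ : ℝ) ^ 2) ^ (cutoff γ + 1) +
      (√(Real.exp (4 * q * (ℓ : ℝ) ^ 2) - 1 + 2 * unbalancedProb (ℓ * n) n ℓ C) +
        unbalancedProb (ℓ * n) n ℓ C) := by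
    refine (Finset.sum_le_sum fun G _ => abs_sub_le _ (splitMass ℓ n q C G) _).trans ?_
    rw [Finset.sum_add_distrib]
    exact add_le_add (sum_abs_cliqueMass_sub_splitMass_le hℓ hn hγ₀ hγ hq₀ hq C)
      (sum_abs_splitMass_sub_le hℓ hn hC hq₀ hq)
  have hu₀ := unbalancedProb_nonneg (ℓ * n) n ℓ C
  have hu := unbalancedProb_le hn ℓ C
  have hx : 0 ≤ q * (ℓ : ℝ) ^ 2 := by positivity
  have he : Real.exp (4 * q * (ℓ : ℝ) ^ 2) ≤
      Real.exp (72 * Real.exp 1 ^ 2 * q * (ℓ : ℝ) ^ 2) := by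
    refine Real.exp_le_exp.2 ?_
    have h2 : (1 : ℝ) ≤ Real.exp 1 ^ 2 := one_le_pow₀ (Real.one_le_exp zero_le_one)
    nlinarith [mul_le_mul_of_nonneg_right h2 hx]
  have he1 : 1 ≤ Real.exp (4 * q * (ℓ : ℝ) ^ 2) := Real.one_le_exp (by positivity)
  -- Subadditivity of the root, together with `2k exp(-ℓ/18) = (2 √(k/2) exp(-ℓ/36))²`.
  have h2 : √(Real.exp (4 * q * (ℓ : ℝ) ^ 2) - 1 + 2 * unbalancedProb (ℓ * n) n ℓ C) ≤
      √(Real.exp (72 * Real.exp 1 ^ 2 * q * (ℓ : ℝ) ^ 2) - 1) +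
        2 * (√(0.5 * (C.ncard : ℝ)) * Real.exp (-(ℓ : ℝ) / 36)) := by
    refine (Real.sqrt_le_sqrt (add_le_add (sub_le_sub_right he 1)
      (mul_le_mul_of_nonneg_left hu zero_le_two))).trans ?_
    refine (sqrt_add_le (by linarith) (by positivity)).trans ?_
    refine add_le_add le_rfl (le_of_eq ?_)
    have h3 : 2 * ((C.ncard : ℝ) * Real.exp (-(ℓ : ℝ) / 18)) =
        (2 * (√(0.5 * (C.ncard : ℝ)) * Real.exp (-(ℓ : ℝ) / 36))) ^ 2 := by
      rw [mul_pow, mul_pow, Real.sq_sqrt (by positivity), ← Real.exp_nat_mul]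
      have : ((2 : ℕ) : ℝ) * (-(ℓ : ℝ) / 36) = -(ℓ : ℝ) / 18 := by
        push_cast
        ring
      rw [this]
      ring
    rw [h3, Real.sqrt_sq (by positivity)]
  -- After halving, the argument yields only `0.5 k exp(-ℓ/18)` and no `exp(-K/12)`; the rest of
  -- these two terms is slack.
  have h4 := Real.exp_pos (-((C.ncard * ℓ : ℕ) : ℝ) / 12)
  have h5 : 0 ≤ (C.ncard : ℝ) * Real.exp (-(ℓ : ℝ) / 18) := by positivity
  linarith

/-- Convexity: the output law is the average over `C` of the laws for a fixed clique, each close to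
the same target. -/
theorem tvDist_plantedClique_bind_reduction_le (hℓ : 1 ≤ ℓ) (hn : 1 ≤ n) (hγ₀ : 0 < γ)
    (hγ : γ ≤ 1 / 2) (hq₀ : 0 ≤ q) (hq : 16 * q * (ℓ : ℝ) ^ 2 ≤ 1) {k : ℕ} (hk₁ : 1 ≤ k)
    (hk : k ≤ n) :
    tvDist ((plantedClique n k γ).bind (reduction ℓ n γ q))
        (plantedDense (ℓ * n) (k * ℓ) (2 * q) q)
      ≤ Real.exp (-((k * ℓ : ℕ) : ℝ) / 12)
        + 1.5 * (k : ℝ) * Real.exp (-(ℓ : ℝ) / 18)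
        + 2 * (k : ℝ) ^ 2 * (8 * q * (ℓ : ℝ) ^ 2) ^ (cutoff γ + 1)
        + 0.5 * Real.sqrt (Real.exp (72 * Real.exp 1 ^ 2 * q * (ℓ : ℝ) ^ 2) - 1)
        + Real.sqrt (0.5 * (k : ℝ)) * Real.exp (-(ℓ : ℝ) / 36) := by
  have hq' := le_one_div_sixteen hℓ hq₀ hq
  set U : Set (Fin n) → ℝ := fun C => (uniformOn {C : Set (Fin n) | C.ncard = k}).real {C}
  have hne : {C : Set (Fin n) | C.ncard = k}.Nonempty := by
    obtain ⟨C, -, hC⟩ := Set.exists_subset_card_eq (s := (Set.univ : Set (Fin n))) (n := k)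
      (by simpa [Set.ncard_univ] using hk)
    exact ⟨C, hC⟩
  have := isProbabilityMeasure_uniformOn (Set.toFinite _) hne
  have hU₁ : ∑ C, U C = 1 := sum_real_singleton _
  have hU₀ : ∀ C, 0 ≤ U C := fun C => measureReal_nonneg
  have hU : ∀ C, C.ncard ≠ k → U C = 0 := fun C hC => by
    simp only [U]
    rw [uniformOn_real_singleton]
    exact if_neg hC
  -- The target does not depend on the choice of `C`, because `K / N = |C| / n`.
  have hT : ∀ C : Set (Fin n), C.ncard = k → ∀ G,
      (plantedDense (ℓ * n) (k * ℓ) (2 * q) q).real {G} = ∑ S, denseJoint q C (S, G) := by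
    intro C hC G
    rw [plantedDense_real (by rw [mul_comm ℓ]; exact Nat.mul_le_mul_right ℓ hk) (by linarith)
      (by linarith) hq₀ (by linarith)]
    have h1 : ((k * ℓ : ℕ) : ℝ) / ((ℓ * n : ℕ) : ℝ) = (C.ncard : ℝ) / n := by
      have : (ℓ : ℝ) ≠ 0 := Nat.cast_ne_zero.2 (by omega)
      rw [hC, Nat.cast_mul, Nat.cast_mul, mul_comm (k : ℝ), mul_div_mul_left _ _ this]
    simp only [h1, denseJoint, setMass]
  rw [tvDist_eq]
  have h1 : ∀ G, |((plantedClique n k γ).bind (reduction ℓ n γ q)).real {G} -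
      (plantedDense (ℓ * n) (k * ℓ) (2 * q) q).real {G}| ≤
        ∑ C, U C * |cliqueMass ℓ n γ q C G - ∑ S, denseJoint q C (S, G)| := by
    intro G
    rw [plantedClique_bind_reduction_real hℓ hn hγ₀ hγ hq₀ hq hk,
      ← one_mul ((plantedDense (ℓ * n) (k * ℓ) (2 * q) q).real {G}), ← hU₁, Finset.sum_mul,
      ← Finset.sum_sub_distrib]
    refine (Finset.abs_sum_le_sum_abs _ _).trans (Finset.sum_le_sum fun C _ => ?_)
    by_cases hC : C.ncard = k
    · rw [hT C hC, ← mul_sub, abs_mul, abs_of_nonneg (hU₀ C)]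
    · have h2 : (uniformOn {C : Set (Fin n) | C.ncard = k}).real {C} = 0 := hU C hC
      simp [hU C hC, h2]
  refine (mul_le_mul_of_nonneg_left (Finset.sum_le_sum fun G _ => h1 G)
    (by norm_num : (0 : ℝ) ≤ 1 / 2)).trans ?_
  rw [Finset.sum_comm, Finset.mul_sum]
  refine (Finset.sum_le_sum (g := fun C => U C * _) fun C _ => ?_).trans_eq
    (by rw [← Finset.sum_mul, hU₁, one_mul])
  rw [← Finset.mul_sum, mul_left_comm]
  by_cases hC : C.ncard = k
  · refine mul_le_mul_of_nonneg_left ?_ (hU₀ C)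
    have h2 := sum_abs_cliqueMass_sub_le (C := C) hℓ hn (by omega) hγ₀ hγ hq₀ hq
    rw [hC] at h2
    exact h2
  · rw [hU C hC, zero_mul, zero_mul]

end Bound

end PlantedReduction

open PlantedReduction in
theorem mainTheorem3 (ℓ n : ℕ) (hℓ : 1 ≤ ℓ) (hn : 1 ≤ n) (γ q : ℝ) (hγ₀ : 0 < γ)
    (hγ : γ ≤ 1 / 2) (hq₀ : 0 ≤ q) (hq : 16 * q * (ℓ : ℝ) ^ 2 ≤ 1) :
    (∀ a b : ℕ, a ≤ 2 * ℓ → b ≤ 2 * ℓ →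
      IsMassFunction (a * b) (massP γ q (a * b)) ∧ IsMassFunction (a * b) (massQ γ q (a * b))) ∧
    (∀ A : SimpleGraph (Fin n), MeasureTheory.IsProbabilityMeasure (reduction ℓ n γ q A)) ∧
    (erdosRenyi n γ).bind (reduction ℓ n γ q) = erdosRenyi (ℓ * n) q ∧
    ∀ k : ℕ, 1 ≤ k → k ≤ n → 6 * Real.exp 1 * (ℓ : ℝ) ≤ (k : ℝ) →
      tvDist ((plantedClique n k γ).bind (reduction ℓ n γ q))
          (plantedDense (ℓ * n) (k * ℓ) (2 * q) q)
        ≤ Real.exp (-((k * ℓ : ℕ) : ℝ) / 12)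
          + 1.5 * (k : ℝ) * Real.exp (-(ℓ : ℝ) / 18)
          + 2 * (k : ℝ) ^ 2 * (8 * q * (ℓ : ℝ) ^ 2) ^ (cutoff γ + 1)
          + 0.5 * Real.sqrt (Real.exp (72 * Real.exp 1 ^ 2 * q * (ℓ : ℝ) ^ 2) - 1)
          + Real.sqrt (0.5 * (k : ℝ)) * Real.exp (-(ℓ : ℝ) / 36) := by
  refine ⟨fun a b ha hb => ?_, isProbabilityMeasure_reduction hℓ hn hγ₀ hγ hq₀ hq,
    erdosRenyi_bind_reduction hℓ hn hγ₀ hγ hq₀ hq, fun k hk₁ hk _ =>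
      tvDist_plantedClique_bind_reduction_le hℓ hn hγ₀ hγ hq₀ hq hk₁ hk⟩
  have hq' := le_one_div_sixteen hℓ hq₀ hq
  have hL := blockSize_mul_le hq₀ hq ha hb
  exact ⟨isMassFunction_massP hγ₀ hγ hq₀ hq' hL, isMassFunction_massQ hγ₀ hγ hq₀ hq' hL⟩
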